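/- Let $\mathbb T^1=\mathbb R/\mathbb Z$ with its geodesic distance $d$, and let $\mathbb T^2=\mathbb R^2/\mathbb Z^2$ carry the flat geodesic distance and Lebesgue measure $\mathrm{Leb}$. Let $K_0,K_1>0$, $M_0\in\mathbb N$ and $\alpha\in(0,1]$. There is a constant $L_0=L_0(K_0,K_1,M_0,\alpha)>0$ such that the following holds. Let $L_1\le L_2\le\cdots$ be a nondecreasing sequence of reals with $L_1\ge L_0$. For each $n\ge1$ let $f_n$ be a $C^3$ function on $\mathbb T^1$, real-valued or, more generally, given by a $C^3$ lift $f_n:\mathbb R\to\mathbb R$ such that $f_n(x+1)-f_n(x)$ is a constant integer (for instance $f_n(x)=L_n\sin(2\pi x)+2x$), such that (H1) $\|f_n'\|_{C^0}+\|f_n''\|_{C^0}\le K_0L_n$; (H2) $\mathcal C_n=\{x\in\mathbb T^1: f_n'(x)=0\}$ is finite, of cardinality at most $M_0$; (H3) $\mathcal C_n\neq\emptyset$, and $|f_n'(x)|\ge L_nK_1^{-1}d(x,\mathcal C_n)$ for all $x\in\mathbb T^1$. Let $F_n:\mathbb T^2\to\mathbb T^2$, $F_n(x,y)=(f_n(x)-y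 \bmod 1,\;x)$, and let $F^n=F_n\circ\cdots\circ F_1$, $F^0=\mathrm{Id}$. Let $\varphi:\mathbb T^2\to\mathbb R$ be $\alpha$-Hölder continuous with $\int\varphi\,d\mathrm{Leb}=0$. (a) If $N^2L_N^{-\alpha/(3\alpha+4)}\to0$ as $N\to\infty$, then $\frac1N\sum_{i=0}^N\varphi\circ F^i\to0$ in $L^2(\mathrm{Leb})$. (b) If $N^{4+\epsilon}L_N^{-\alpha/(3\alpha+4)}\to0$ as $N\to\infty$ for some $\epsilon>0$, then $\frac1N\sum_{i=0}^N\varphi\circ F^i\to0$ Lebesgue-almost everywhere. -/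

import Mathlib

open Filter Topology MeasureTheory

namespace NonautStdMap

/-- The one-dimensional torus `ℝ / ℤ`, with its geodesic distance and Lebesgue measure of mass 1. -/
abbrev T1 : Type := UnitAddCircle

/-- The two-dimensional torus. Its `volume` is the product measure, i.e. Lebesgue measure. -/
abbrev T2 : Type := T1 × T1

/-- The geodesic distance on the flat torus `ℝ² / ℤ²`. -/
noncomputable def torusDist (p q : T2) : ℝ :=
  Real.sqrt (dist p.1 q.1 ^ 2 + dist p.2 q.2 ^ 2)

/-- `φ` is Hölder continuous with exponent `α` on the flat torus. -/
def IsHolder (α : ℝ) (φ : T2 → ℝ) : Prop :=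
  ∃ C : ℝ, ∀ p q : T2, |φ p - φ q| ≤ C * torusDist p q ^ α

/-- The uniform norm of a (bounded) function on the line. It is only applied to continuous
`1`-periodic functions. -/
noncomputable def supNorm (g : ℝ → ℝ) : ℝ := ⨆ x : ℝ, |g x|

/-- The critical set of `f`, as a subset of the circle. -/
def critSet (f : ℝ → ℝ) : Set T1 :=
  (fun x : ℝ => (x : T1)) '' {x : ℝ | deriv f x = 0}

/-- The conditions on one function `f` with coefficient `L`. The function on the circle is given by
a lift `f : ℝ → ℝ` that is well defined modulo 1 on `ℝ / ℤ`: both real-valued functions on the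
circle (`k = 0`) and functions such as `L sin (2 π x) + 2 x` (`k = 2`) are covered.
The critical set is automatically nonempty when `k = 0`; in general this is what the lower bound
by the distance to it means, the distance to the empty set being infinite
(`Metric.infDist` gives `0` there). -/
structure Admissible (K₀ K₁ : ℝ) (M₀ : ℕ) (L : ℝ) (f : ℝ → ℝ) : Prop where
  contDiff : ContDiff ℝ 3 f
  lift : ∃ k : ℤ, ∀ x : ℝ, f (x + 1) = f x + k
  h1 : supNorm (deriv f) + supNorm (deriv (deriv f)) ≤ K₀ * L
  h2 : (critSet f).Finite ∧ (critSet f).ncard ≤ M₀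
  h3 : (critSet f).Nonempty ∧
    ∀ x : ℝ, L * K₁⁻¹ * Metric.infDist (x : T1) (critSet f) ≤ |deriv f x|

/-- The representative in `[0, 1)` of a point of the circle. -/
noncomputable def rep (x : T1) : ℝ := (AddCircle.equivIco (1 : ℝ) 0 x : ℝ)

/-- The generalized standard map `(x, y) ↦ (f x - y mod 1, x)`. -/
noncomputable def stdMap (f : ℝ → ℝ) (p : T2) : T2 :=
  ((f (rep p.1) : T1) - p.2, p.1)

/-- The composition `Fⁿ = F_n ∘ ⋯ ∘ F_1` with `F⁰ = id`, where `F_n` is the map given by `f n`. -/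
noncomputable def compMap (f : ℕ → ℝ → ℝ) : ℕ → T2 → T2
  | 0 => id
  | n + 1 => stdMap (f (n + 1)) ∘ compMap f n

/-- The average `(1 / N) ∑_{i = 0}^{N} φ ∘ Fⁱ`. -/
noncomputable def timeAverage (f : ℕ → ℝ → ℝ) (φ : T2 → ℝ) (N : ℕ) (p : T2) : ℝ :=
  (1 / (N : ℝ)) * ∑ i ∈ Finset.range (N + 1), φ (compMap f i p)

end NonautStdMap

/-!
The maps preserve Lebesgue measure, so both parts follow from decay of the correlations
`∫ φ ∘ Fⁱ · φ ∘ Fʲ` for `j ≥ i + 2`. With correlations `O(1 / i)` the second moment of a sum of `N`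
terms is `O(N ^ (3 / 2))` (`integral_sum_sq_le`); this gives `L²` convergence of the averages, and
almost everywhere convergence through Borel–Cantelli along the fourth powers
(`tendsto_eLpNorm_average`, `ae_tendsto_average`).

For the correlations, consider nearly horizontal curves `y = g x` over unit intervals (`IsCurve`),
carrying the measure `dx`. Write `L = r ^ 4`. Away from the `1 / r`-neighbourhood of the critical
set, the map `x ↦ f x - g x` expands by at least a multiple of `r ^ 3` while its second derivative
is `O(r ^ 4)`. In the coordinate `v = f x - g x` the image of the curve consists of many full turns
of the circle, each of which is again a nearly horizontal curve carrying an almost uniform density.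
Up to a loss `O(1 / r)`, integrating `Ψ ∘ F` over a curve is therefore an average of integrals of
`Ψ` over curves (`sum_abs_integral_le`). In the last step one subtracts from `φ` its average over
the first coordinate: what is left has small integrals over nearly horizontal turns, and the average
integrates to zero (`abs_integral_stdMap_curve_le`). In the first step `φ` is frozen on intervals of
length `1 / r` (`abs_correlation_le`).

The correlations are thus bounded by a multiple of `∑ L_k ^ (-α / 4)` over the steps `k` between `i`
and `j`. Since `α / (3 α + 4) ≤ α / 4`, either hypothesis makes the terms `O(1 / k ^ 2)`, and the
sum is `O(1 / i)`. The threshold `L₀` only serves to make the class of curves invariant.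
-/

namespace NonautStdMap

/-! ### Curves and inverse branches -/

/-- The graph `y = g x` is an almost horizontal curve: the slope `g'` is at most `θ` in absolute
value and `1`-Lipschitz. Curves are graphs over the whole line; only their pieces over intervals of
length one are integrated against. -/
structure IsCurve (θ : ℝ) (g g' : ℝ → ℝ) : Prop where
  hasDerivAt : ∀ x, HasDerivAt g (g' x) x
  abs_slope_le : ∀ x, |g' x| ≤ θ
  slope_lip : ∀ x y, |g' x - g' y| ≤ |x - y|

lemma abs_sub_le_of_hasDerivAt {u d : ℝ → ℝ} {D : ℝ} (hu : ∀ x, HasDerivAt u (d x) x)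
    (hD : ∀ x, |d x| ≤ D) (x y : ℝ) : |u x - u y| ≤ D * |x - y| := by
  have := Convex.norm_image_sub_le_of_norm_hasDerivWithin_le (f := u) (f' := d) (s := Set.univ)
    (x := y) (y := x) (C := D) (fun x _ => (hu x).hasDerivWithinAt) (fun x _ => hD x) convex_univ
    (Set.mem_univ _) (Set.mem_univ _)
  simpa [Real.norm_eq_abs] using this

lemma IsCurve.abs_sub_le {θ : ℝ} {g g' : ℝ → ℝ} (hg : IsCurve θ g g') (x y : ℝ) :
    |g x - g y| ≤ θ * |x - y| :=
  abs_sub_le_of_hasDerivAt hg.hasDerivAt hg.abs_slope_le x y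

lemma IsCurve.continuous {θ : ℝ} {g g' : ℝ → ℝ} (hg : IsCurve θ g g') : Continuous g :=
  continuous_iff_continuousAt.2 fun x => (hg.hasDerivAt x).continuousAt

lemma IsCurve.mono {θ θ' : ℝ} {g g' : ℝ → ℝ} (hg : IsCurve θ g g') (h : θ ≤ θ') :
    IsCurve θ' g g' :=
  ⟨hg.hasDerivAt, fun x => (hg.abs_slope_le x).trans h, hg.slope_lip⟩

lemma IsCurve.comp_neg {θ : ℝ} {g g' : ℝ → ℝ} (hg : IsCurve θ g g') :
    IsCurve θ (fun x => g (-x)) (fun x => -g' (-x)) where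
  hasDerivAt x := by
    have := (hg.hasDerivAt (-x)).comp x (hasDerivAt_neg x)
    simpa [Function.comp_def] using this
  abs_slope_le x := by simpa using hg.abs_slope_le (-x)
  slope_lip x y := by
    have := hg.slope_lip (-y) (-x)
    have e1 : -g' (-x) - -g' (-y) = g' (-y) - g' (-x) := by ring
    have e2 : -y - -x = x - y := by ring
    rwa [e1, ← e2]

lemma IsCurve.const (y : ℝ) : IsCurve 1 (fun _ => y) (fun _ => 0) where
  hasDerivAt x := hasDerivAt_const x y
  abs_slope_le x := by simp
  slope_lip x y := by simp

lemma continuous_of_lip {d : ℝ → ℝ} {K : ℝ} (h : ∀ x y, |d x - d y| ≤ K * |x - y|) :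
    Continuous d := by
  refine LipschitzWith.continuous (K := K.toNNReal) (LipschitzWith.of_dist_le_mul fun x y => ?_)
  rw [Real.dist_eq, Real.dist_eq]
  exact (h x y).trans (by gcongr; exact Real.le_coe_toNNReal K)

/-- The inverse of a strongly expanding map of the line is a curve: strong expansion flattens
slopes, and its cube controls the Lipschitz constant of the slope. -/
lemma exists_inverse_curve {u d : ℝ → ℝ} {m Λ : ℝ} (hm : 0 < m)
    (hu : ∀ x, HasDerivAt u (d x) x) (hd : ∀ x, m ≤ d x)
    (hlip : ∀ x y, |d x - d y| ≤ Λ * |x - y|) (hΛ : Λ ≤ m ^ 3) :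
    ∃ w : ℝ → ℝ, (∀ x, w (u x) = x) ∧ IsCurve (1 / m) w (fun v => (d (w v))⁻¹) ∧
      (∀ v, u (w v) = v) ∧
      ∀ v v', |(d (w v))⁻¹ - (d (w v'))⁻¹| ≤ Λ / m ^ 3 * |v - v'| := by
  have hexp : ∀ x y, x ≤ y → m * (y - x) ≤ u y - u x := fun x y hxy =>
    convex_univ.mul_sub_le_image_sub_of_le_deriv
      (fun z _ => (hu z).continuousAt.continuousWithinAt)
      (fun z _ => (hu z).differentiableAt.differentiableWithinAt)
      (fun z _ => by rw [(hu z).deriv]; exact hd z) x (Set.mem_univ _) y (Set.mem_univ _) hxy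
  have hmono : StrictMono u := fun x y hxy => by
    have := hexp x y hxy.le
    nlinarith [mul_pos hm (sub_pos.2 hxy)]
  have hcont : Continuous u := continuous_iff_continuousAt.2 fun x => (hu x).continuousAt
  have htop : Tendsto u atTop atTop := by
    refine tendsto_atTop_mono' _ ?_
      (tendsto_atTop_add_const_left atTop (u 0) (tendsto_id.const_mul_atTop hm))
    filter_upwards [eventually_ge_atTop 0] with x hx
    have := hexp 0 x hx
    simp only [id]; linarith
  have hbot : Tendsto u atBot atBot := by
    refine tendsto_atBot_mono' _ ?_
      (tendsto_atBot_add_const_left atBot (u 0) (tendsto_id.const_mul_atBot hm))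
    filter_upwards [eventually_le_atBot 0] with x hx
    have := hexp x 0 hx
    simp only [id]; linarith
  set e := hmono.orderIsoOfSurjective u (hcont.surjective htop hbot) with he
  have heu : ∀ x, e x = u x := fun x => rfl
  have huw : ∀ v, u (e.symm v) = v := fun v => by rw [← heu]; exact e.apply_symm_apply v
  have hpos : ∀ x, 0 < d x := fun x => hm.trans_le (hd x)
  have hw : ∀ v, HasDerivAt (fun v => e.symm v) ((d (e.symm v))⁻¹) v := fun v =>
    HasDerivAt.of_local_left_inverse e.symm.continuous.continuousAt (hu _) (hpos _).ne'
      (Eventually.of_forall huw)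
  have hinv : ∀ x, |(d x)⁻¹| ≤ 1 / m := fun x => by
    rw [abs_of_pos (inv_pos.2 (hpos x)), inv_eq_one_div]
    exact one_div_le_one_div_of_le hm (hd x)
  have hlip' : ∀ v v', |(d (e.symm v))⁻¹ - (d (e.symm v'))⁻¹| ≤ Λ / m ^ 3 * |v - v'| := by
    intro v v'
    have h1 := abs_sub_le_of_hasDerivAt hw (fun x => hinv _) v v'
    have h2 := hlip (e.symm v') (e.symm v)
    set a := e.symm v
    set b := e.symm v'
    have hΛ0 : 0 ≤ Λ := by
      have := (abs_nonneg _).trans (hlip 1 0)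
      simpa using this
    rw [inv_sub_inv (hpos a).ne' (hpos b).ne', abs_div, abs_of_pos (mul_pos (hpos a) (hpos b)),
      div_le_iff₀ (mul_pos (hpos a) (hpos b))]
    have h3 : m * m ≤ d a * d b := mul_le_mul (hd a) (hd b) hm.le (hpos a).le
    calc |d b - d a| ≤ Λ * |b - a| := h2
      _ ≤ Λ * (1 / m * |v - v'|) := by rw [abs_sub_comm b a]; gcongr
      _ = Λ / m ^ 3 * |v - v'| * (m * m) := by field_simp
      _ ≤ Λ / m ^ 3 * |v - v'| * (d a * d b) := by gcongr
  refine ⟨fun v => e.symm v, fun x => ?_, ⟨hw, fun v => hinv _, fun v v' => ?_⟩, huw, hlip'⟩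
  · exact e.symm_apply_apply x
  · refine (hlip' v v').trans (mul_le_of_le_one_left (abs_nonneg _) ?_)
    exact (div_le_one (by positivity)).2 hΛ

/-! ### Integrals over images of curves -/

/-- If the integral of `h` over every unit interval is dominated by that of `ρ ≥ 0`, then the
integral over any interval is dominated up to the contribution of one incomplete unit interval. -/
lemma abs_integral_le_of_unit_intervals {h ρ : ℝ → ℝ} {b : ℝ} (hh : Continuous h)
    (hρ : Continuous ρ) (hρ0 : ∀ x, 0 ≤ ρ x) (hb : ∀ x, |h x| ≤ b)
    (hunit : ∀ c : ℝ, |∫ x in c..c + 1, h x| ≤ ∫ x in c..c + 1, ρ x) {p q : ℝ} (hpq : p ≤ q) :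
    |∫ x in p..q, h x| ≤ (∫ x in p..q, ρ x) + b := by
  have hb0 : 0 ≤ b := (abs_nonneg _).trans (hb 0)
  obtain ⟨K, hK⟩ := exists_nat_ge (q - p)
  induction K generalizing p with
  | zero =>
    have : p = q := by push_cast at hK; linarith
    subst this; simpa using hb0
  | succ K ih =>
    rcases le_total q (p + 1) with h1 | h1
    · have h2 := intervalIntegral.norm_integral_le_of_norm_le_const (a := p) (b := q) (f := h)
        (C := b) (fun x _ => hb x)
      rw [Real.norm_eq_abs, abs_of_nonneg (sub_nonneg.2 hpq)] at h2
      have h3 : 0 ≤ ∫ x in p..q, ρ x := intervalIntegral.integral_nonneg hpq fun x _ => hρ0 x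
      nlinarith
    · have h2 := ih h1 (by push_cast at hK; linarith)
      rw [← intervalIntegral.integral_add_adjacent_intervals (hh.intervalIntegrable p (p + 1))
          (hh.intervalIntegrable (p + 1) q),
        ← intervalIntegral.integral_add_adjacent_intervals (hρ.intervalIntegrable p (p + 1))
          (hρ.intervalIntegrable (p + 1) q)]
      have h3 := abs_add_le (∫ x in p..p + 1, h x) (∫ x in p + 1..q, h x)
      linarith [hunit p]

/-- The change of variables `v = u x` turns the integral of `Ψ` over the image of a curve under the
map into integrals over unit pieces of the curve `(v, u⁻¹ v)`, weighted by a density that is almost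
constant on each of them. -/
lemma abs_integral_le_of_le_deriv {Ψ : ℝ → ℝ → ℝ} (hΨ : Continuous fun p : ℝ × ℝ => Ψ p.1 p.2)
    {u d : ℝ → ℝ} {m Λ D S B : ℝ} (hm : 0 < m)
    (hu : ∀ x, HasDerivAt u (d x) x) (hd : ∀ x, m ≤ d x)
    (hlip : ∀ x y, |d x - d y| ≤ Λ * |x - y|) (hΛ : Λ ≤ m ^ 3) (hD : ∀ x, d x ≤ D)
    (hB : ∀ a b, |Ψ a b| ≤ B)
    (hS : ∀ w w' : ℝ → ℝ, IsCurve (1 / m) w w' → ∀ c : ℝ, |∫ v in c..c + 1, Ψ v (w v)| ≤ S)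
    {s t : ℝ} (hst : s ≤ t) :
    |∫ x in s..t, Ψ (u x) x| ≤ (S + B * (Λ / m ^ 3 * D)) * (t - s) + B / m := by
  obtain ⟨w, hwu, hw, huw, hwlip⟩ := exists_inverse_curve hm hu hd hlip hΛ
  set w' : ℝ → ℝ := fun v => (d (w v))⁻¹ with hw'
  set lam := Λ / m ^ 3 with hlam
  have hlam0 : 0 ≤ lam := by
    have := (abs_nonneg _).trans (hwlip 1 0)
    simpa using this
  have hB0 : 0 ≤ B := (abs_nonneg _).trans (hB 0 0)
  have hS0 : 0 ≤ S := (abs_nonneg _).trans (hS w w' hw 0)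
  have hw'0 : ∀ v, 0 ≤ w' v := fun v => inv_nonneg.2 (hm.le.trans (hd _))
  have hw'm : ∀ v, w' v ≤ 1 / m := fun v => (le_abs_self _).trans (hw.abs_slope_le v)
  have hw'c : Continuous w' := continuous_of_lip hwlip
  have hwc := hw.continuous
  have huc : Continuous u := continuous_iff_continuousAt.2 fun x => (hu x).continuousAt
  have hΨw : Continuous fun v => Ψ v (w v) :=
    hΨ.comp (continuous_id.prodMk hwc)
  have hchange : ∫ x in s..t, Ψ (u x) x = ∫ v in u s..u t, Ψ v (w v) * w' v := by
    have h := intervalIntegral.integral_comp_mul_deriv (a := u s) (b := u t) (f := w) (f' := w')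
      (g := fun x => Ψ (u x) x) (fun x _ => hw.hasDerivAt x) hw'c.continuousOn
      (hΨ.comp (huc.prodMk continuous_id))
    rw [hwu, hwu] at h
    rw [← h]
    simp only [Function.comp, huw]
  have hlen : ∫ v in u s..u t, w' v = t - s := by
    rw [intervalIntegral.integral_eq_sub_of_hasDerivAt (fun x _ => hw.hasDerivAt x)
      (hw'c.intervalIntegrable _ _), hwu, hwu]
  have humono : 0 ≤ u t - u s ∧ u t - u s ≤ D * (t - s) := by
    have hpos : ∀ x, |d x| ≤ D := fun x => by
      rw [abs_of_pos (hm.trans_le (hd x))]; exact hD x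
    have h1 := abs_sub_le_of_hasDerivAt hu hpos t s
    rw [abs_of_nonneg (sub_nonneg.2 hst)] at h1
    refine ⟨sub_nonneg.2 ?_, (le_abs_self _).trans h1⟩
    exact monotone_of_deriv_nonneg (fun x => (hu x).differentiableAt)
      (fun x => by rw [(hu x).deriv]; exact hm.le.trans (hd x)) hst
  have key := abs_integral_le_of_unit_intervals (h := fun v => Ψ v (w v) * w' v)
    (ρ := fun v => S * w' v + B * lam) (b := B / m) (by fun_prop) (by fun_prop)
    (fun v => by have := hw'0 v; positivity)
    (fun v => by
      rw [abs_mul, abs_of_nonneg (hw'0 v), div_eq_mul_one_div]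
      exact mul_le_mul (hB _ _) (hw'm v) (hw'0 v) hB0)
    (fun c => by
      -- The density is compared with its mean over the unit interval.
      set μ := ∫ v in c..c + 1, w' v with hμ
      have hμ0 : 0 ≤ μ := intervalIntegral.integral_nonneg (by linarith) fun v _ => hw'0 v
      have hdev : ∀ v ∈ Set.uIoc c (c + 1), ‖Ψ v (w v) * (w' v - μ)‖ ≤ B * lam := by
        intro v hv
        rw [Set.uIoc_of_le (by linarith)] at hv
        have h1 : w' v - μ = ∫ z in c..c + 1, (w' v - w' z) := by
          rw [intervalIntegral.integral_sub (by simp) (hw'c.intervalIntegrable _ _)]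
          simp [hμ]
        have h2 : |w' v - μ| ≤ lam := by
          have h3 := intervalIntegral.norm_integral_le_of_norm_le_const (a := c) (b := c + 1)
            (f := fun z => w' v - w' z) (C := lam) (fun z hz => by
              rw [Set.uIoc_of_le (by linarith)] at hz
              refine (hwlip v z).trans (mul_le_of_le_one_right hlam0 ?_)
              rw [abs_le]; constructor <;> linarith [hv.1, hv.2, hz.1, hz.2])
          rw [h1]
          simpa using h3
        rw [Real.norm_eq_abs, abs_mul]
        exact mul_le_mul (hB _ _) h2 (abs_nonneg _) hB0
      have hsplit : ∫ v in c..c + 1, Ψ v (w v) * w' v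
          = μ * (∫ v in c..c + 1, Ψ v (w v)) + ∫ v in c..c + 1, Ψ v (w v) * (w' v - μ) := by
        rw [← intervalIntegral.integral_const_mul, ← intervalIntegral.integral_add]
        · congr 1; ext v; ring
        · exact (hΨw.const_mul μ).intervalIntegrable _ _
        · exact (hΨw.mul (hw'c.sub continuous_const)).intervalIntegrable _ _
      have h4 := intervalIntegral.norm_integral_le_of_norm_le_const hdev
      rw [Real.norm_eq_abs] at h4
      have h5 : ∫ v in c..c + 1, (S * w' v + B * lam) = S * μ + B * lam := by
        rw [intervalIntegral.integral_add ((hw'c.const_mul S).intervalIntegrable _ _) (by simp),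
          intervalIntegral.integral_const_mul]
        simp [hμ]
      rw [h5, hsplit]
      refine (abs_add_le _ _).trans (add_le_add ?_ (by simpa using h4))
      rw [abs_mul, abs_of_nonneg hμ0, mul_comm]
      exact mul_le_mul_of_nonneg_right (hS w w' hw c) hμ0)
    (p := u s) (q := u t) (by linarith [humono.1])
  rw [hchange]
  refine key.trans (add_le_add_left ?_ _)
  rw [intervalIntegral.integral_add ((hw'c.const_mul S).intervalIntegrable _ _) (by simp),
    intervalIntegral.integral_const_mul, hlen]
  simp only [intervalIntegral.integral_const, smul_eq_mul]
  have : (u t - u s) * (B * lam) ≤ D * (t - s) * (B * lam) :=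
    mul_le_mul_of_nonneg_right humono.2 (by positivity)
  linarith

/-- Variant of `abs_integral_le_of_le_deriv` in which the derivative is positive and large
only on the interval of integration; off it the derivative is replaced by a constant. -/
lemma abs_integral_le_of_le_deriv_on {Ψ : ℝ → ℝ → ℝ}
    (hΨ : Continuous fun p : ℝ × ℝ => Ψ p.1 p.2)
    {u d : ℝ → ℝ} {m Λ D S B s t : ℝ} (hst : s ≤ t) (hm : 0 < m)
    (hu : ∀ x, HasDerivAt u (d x) x) (hd : ∀ x ∈ Set.Icc s t, m ≤ d x)
    (hlip : ∀ x y, |d x - d y| ≤ Λ * |x - y|) (hΛ : Λ ≤ m ^ 3) (hD : ∀ x, |d x| ≤ D)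
    (hB : ∀ a b, |Ψ a b| ≤ B)
    (hS : ∀ w w' : ℝ → ℝ, IsCurve (1 / m) w w' → ∀ c : ℝ, |∫ v in c..c + 1, Ψ v (w v)| ≤ S) :
    |∫ x in s..t, Ψ (u x) x| ≤ (S + B * (Λ / m ^ 3 * D)) * (t - s) + B / m := by
  have hΛ0 : 0 ≤ Λ := by
    have := (abs_nonneg _).trans (hlip 1 0)
    simpa using this
  set P : ℝ → ℝ := fun x => Set.projIcc s t hst x with hP
  have hPlip : ∀ x y, |P x - P y| ≤ |x - y| := fun x y => by
    have := (LipschitzWith.projIcc hst).dist_le_mul x y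
    simpa [Subtype.dist_eq, Real.dist_eq] using this
  set d₁ : ℝ → ℝ := fun x => d (P x) with hd₁
  set u₁ : ℝ → ℝ := fun x => u s + ∫ z in s..x, d₁ z with hu₁
  have hlip₁ : ∀ x y, |d₁ x - d₁ y| ≤ Λ * |x - y| := fun x y =>
    (hlip _ _).trans (mul_le_mul_of_nonneg_left (hPlip x y) hΛ0)
  have hd₁c : Continuous d₁ := continuous_of_lip hlip₁
  have hdc : Continuous d := continuous_of_lip hlip
  have hu₁d : ∀ x, HasDerivAt u₁ (d₁ x) x := fun x =>
    (intervalIntegral.integral_hasDerivAt_right (hd₁c.intervalIntegrable _ _)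
      (hd₁c.stronglyMeasurableAtFilter _ _) hd₁c.continuousAt).const_add (u s)
  have heq : ∀ x ∈ Set.Icc s t, u₁ x = u x := by
    intro x hx
    have h1 : ∫ z in s..x, d₁ z = ∫ z in s..x, d z := by
      refine intervalIntegral.integral_congr fun z hz => ?_
      rw [Set.uIcc_of_le hx.1] at hz
      have : P z = z := by
        simp only [hP]
        rw [Set.projIcc_of_mem hst ⟨hz.1, hz.2.trans hx.2⟩]
      simp only [hd₁, this]
    simp only [hu₁]
    rw [h1, intervalIntegral.integral_eq_sub_of_hasDerivAt (fun z _ => hu z)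
      (hdc.intervalIntegrable _ _)]
    ring
  have h2 : ∫ x in s..t, Ψ (u x) x = ∫ x in s..t, Ψ (u₁ x) x := by
    refine intervalIntegral.integral_congr fun x hx => ?_
    rw [Set.uIcc_of_le hst] at hx
    simp only [heq x hx]
  rw [h2]
  exact abs_integral_le_of_le_deriv hΨ hm hu₁d (fun x => hd _ (Set.projIcc s t hst x).2) hlip₁ hΛ
    (fun x => (le_abs_self _).trans (hD _)) hB hS hst

lemma abs_integral_le_of_le_abs_deriv_on {Ψ : ℝ → ℝ → ℝ}
    (hΨ : Continuous fun p : ℝ × ℝ => Ψ p.1 p.2)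
    {u d : ℝ → ℝ} {m Λ D S B s t : ℝ} (hst : s ≤ t) (hm : 0 < m)
    (hu : ∀ x, HasDerivAt u (d x) x) (hd : ∀ x ∈ Set.Icc s t, m ≤ |d x|)
    (hlip : ∀ x y, |d x - d y| ≤ Λ * |x - y|) (hΛ : Λ ≤ m ^ 3) (hD : ∀ x, |d x| ≤ D)
    (hB : ∀ a b, |Ψ a b| ≤ B)
    (hS : ∀ w w' : ℝ → ℝ, IsCurve (1 / m) w w' → ∀ c : ℝ, |∫ v in c..c + 1, Ψ v (w v)| ≤ S) :
    |∫ x in s..t, Ψ (u x) x| ≤ (S + B * (Λ / m ^ 3 * D)) * (t - s) + B / m := by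
  have hdc : Continuous d := continuous_of_lip hlip
  have hsign : (∀ x ∈ Set.Icc s t, m ≤ d x) ∨ ∀ x ∈ Set.Icc s t, m ≤ -d x := by
    by_contra! hcon
    obtain ⟨⟨x, hx, hx'⟩, y, hy, hy'⟩ := hcon
    have hx1 : d x < 0 := by
      rcases le_abs'.1 (hd x hx) with h | h <;> linarith
    have hy1 : 0 < d y := by
      rcases le_abs'.1 (hd y hy) with h | h <;> linarith
    obtain ⟨z, hz, hz'⟩ := isPreconnected_Icc.intermediate_value hx hy hdc.continuousOn
      (show (0 : ℝ) ∈ Set.Icc (d x) (d y) from ⟨hx1.le, hy1.le⟩)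
    have := hd z hz
    rw [hz', abs_zero] at this
    linarith
  rcases hsign with h | h
  · exact abs_integral_le_of_le_deriv_on hΨ hst hm hu h hlip hΛ hD hB hS
  · -- Reflecting the first coordinate exchanges the two signs and preserves the class of curves.
    have := abs_integral_le_of_le_deriv_on (Ψ := fun a b => Ψ (-a) b) (u := fun x => -u x)
      (d := fun x => -d x) (S := S) (D := D) (Λ := Λ) (B := B) (m := m)
      (hΨ.comp ((continuous_fst.neg).prodMk continuous_snd)) hst hm (fun x => (hu x).neg) h
      (fun x y => by rw [neg_sub_neg, abs_sub_comm]; exact hlip x y) hΛ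
      (fun x => by rw [abs_neg]; exact hD x) (fun a b => hB _ _)
      (fun w w' hw c => by
        have h1 := hS _ _ hw.comp_neg (-(c + 1))
        have h2 := intervalIntegral.integral_comp_neg (a := c) (b := c + 1)
          (fun v => Ψ v (w (-v)))
        simp only [neg_neg] at h2
        rw [h2]
        convert h1 using 4
        ring)
    simpa using this

/-! ### Circle geometry -/

lemma dist_coe_le (x y : ℝ) : dist (x : T1) (y : T1) ≤ |x - y| := by
  rw [dist_eq_norm, ← AddCircle.coe_sub, UnitAddCircle.norm_eq]
  have := round_le (x - y) 0
  simpa using this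

instance : IsProbabilityMeasure (volume : Measure T1) := ⟨UnitAddCircle.measure_univ⟩

instance : IsProbabilityMeasure (volume : Measure T2) :=
  inferInstanceAs (IsProbabilityMeasure ((volume : Measure T1).prod volume))

/-- Among the `Q` intervals of a regular partition of a unit interval, at most four per point of
`C` come closer than `1 / Q` to `C` on the circle: they fill disjoint parts of the
`2 / Q`-neighbourhood of `C`. -/
lemma card_close_intervals_le {C : Set T1} (hC : C.Finite) {M : ℕ} (hM : C.ncard ≤ M) (c : ℝ)
    {Q : ℕ} (hQ : 0 < Q) (bad : Finset ℕ) (hbadQ : bad ⊆ Finset.range Q)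
    (hbad : ∀ j ∈ bad, ∃ x ∈ Set.Icc (c + j / Q) (c + (j + 1) / Q), ∃ z ∈ C,
      dist (x : T1) z < 1 / Q) :
    (bad.card : ℝ) ≤ 4 * M := by
  have hQ' : (0 : ℝ) < Q := by exact_mod_cast hQ
  set I : ℕ → Set ℝ := fun j => Set.Ioc (c + j / Q) (c + (j + 1) / Q) with hI
  set A : Set T1 := ⋃ z ∈ C, Metric.closedBall z (2 / Q) with hA
  have hAm : MeasurableSet A :=
    MeasurableSet.biUnion hC.countable fun z _ => measurableSet_closedBall
  have hAvol : volume A ≤ ENNReal.ofReal (M * (4 / Q)) := by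
    have h1 : volume A ≤ ∑ z ∈ hC.toFinset, volume (Metric.closedBall z (2 / Q : ℝ)) := by
      have := measure_biUnion_finset_le (μ := (volume : Measure T1)) hC.toFinset
        (fun z => Metric.closedBall z (2 / Q : ℝ))
      simpa [hA] using this
    refine h1.trans ?_
    have h2 : ∀ z ∈ hC.toFinset, volume (Metric.closedBall z (2 / Q : ℝ))
        ≤ ENNReal.ofReal (4 / Q) := fun z _ => by
      rw [AddCircle.volume_closedBall]
      refine ENNReal.ofReal_le_ofReal ((min_le_right _ _).trans (le_of_eq ?_))
      ring
    refine (Finset.sum_le_card_nsmul _ _ _ h2).trans ?_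
    rw [nsmul_eq_mul, ENNReal.ofReal_mul (by positivity), ENNReal.ofReal_natCast]
    gcongr
    rwa [← Set.ncard_eq_toFinset_card C hC]
  have hsub : ∀ j ∈ bad, I j ⊆ (fun x : ℝ => (x : T1)) ⁻¹' A ∩ Set.Ioc c (c + 1) := by
    intro j hj y hy
    obtain ⟨x, hx, z, hz, hxz⟩ := hbad j hj
    have hjQ : ((j : ℝ) + 1) ≤ Q := by
      exact_mod_cast Finset.mem_range.1 (hbadQ hj)
    have hlen : c + ((j : ℝ) + 1) / Q = c + j / Q + 1 / Q := by ring
    refine ⟨?_, ?_, ?_⟩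
    · simp only [hA, Set.mem_preimage, Set.mem_iUnion, Metric.mem_closedBall]
      refine ⟨z, hz, (dist_triangle _ (x : T1) _).trans ?_⟩
      have h1 : |y - x| ≤ 1 / Q := by
        rw [abs_le]; constructor <;> linarith [hx.1, hx.2, hy.1, hy.2]
      have h2 := (dist_coe_le y x).trans h1
      have h3 : (2 : ℝ) / Q = 1 / Q + 1 / Q := by ring
      linarith
    · have : (0 : ℝ) ≤ j / Q := by positivity
      linarith [hy.1]
    · have : ((j : ℝ) + 1) / Q ≤ 1 := (div_le_one hQ').2 hjQ
      linarith [hy.2]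
  have hdisj : Set.PairwiseDisjoint (bad : Set ℕ) I := by
    intro i _ j _ hij
    wlog h : i < j generalizing i j
    · exact (this ‹_› ‹_› hij.symm (lt_of_le_of_ne (not_lt.1 h) hij.symm)).symm
    refine Set.disjoint_left.2 fun y hy hy' => ?_
    have h1 : ((i : ℝ) + 1) / Q ≤ j / Q := by
      gcongr; exact_mod_cast h
    linarith [hy.2, hy'.1]
  have hunion : volume (⋃ j ∈ bad, I j) = ENNReal.ofReal (bad.card * (1 / Q)) := by
    rw [measure_biUnion_finset hdisj fun _ _ => measurableSet_Ioc]
    have : ∀ j ∈ bad, volume (I j) = ENNReal.ofReal (1 / Q) := fun j _ => by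
      rw [hI, Real.volume_Ioc]; congr 1; ring
    rw [Finset.sum_congr rfl this, Finset.sum_const, nsmul_eq_mul,
      ENNReal.ofReal_mul (by positivity), ENNReal.ofReal_natCast]
  have hle : volume (⋃ j ∈ bad, I j) ≤ volume A := by
    rw [← (UnitAddCircle.measurePreserving_mk c).measure_preimage hAm.nullMeasurableSet,
      Measure.restrict_apply ((UnitAddCircle.measurePreserving_mk c).measurable hAm)]
    exact measure_mono (Set.iUnion₂_subset hsub)
  rw [hunion] at hle
  have h := (ENNReal.ofReal_le_ofReal_iff (by positivity)).1 (hle.trans hAvol)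
  have h1 : (bad.card : ℝ) * (1 / Q) * Q = bad.card := by field_simp
  have h2 : (M : ℝ) * (4 / Q) * Q = 4 * M := by field_simp
  nlinarith [mul_le_mul_of_nonneg_right h hQ'.le]

/-! ### Admissible functions -/

lemma deriv_periodic {f : ℝ → ℝ} {k : ℝ} (h : ∀ x, f (x + 1) = f x + k) :
    Function.Periodic (deriv f) 1 := fun x => by
  rw [← deriv_comp_add_const]
  simp [h]

lemma abs_le_supNorm {g : ℝ → ℝ} (hg : Continuous g) (hp : Function.Periodic g 1) (x : ℝ) :
    |g x| ≤ supNorm g := by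
  refine le_ciSup (f := fun x => |g x|) ?_ x
  have := (hp.isBounded_of_continuous one_ne_zero hg)
  obtain ⟨R, hR⟩ := this.exists_norm_le
  exact ⟨R, by rintro _ ⟨y, rfl⟩; exact hR _ ⟨y, rfl⟩⟩

lemma supNorm_nonneg (g : ℝ → ℝ) : 0 ≤ supNorm g := Real.iSup_nonneg fun _ => abs_nonneg _

namespace Admissible

variable {K₀ K₁ L : ℝ} {M₀ : ℕ} {f : ℝ → ℝ}

lemma hasDerivAt (hf : Admissible K₀ K₁ M₀ L f) (x : ℝ) : HasDerivAt f (deriv f x) x :=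
  (hf.contDiff.differentiable (by norm_num)).differentiableAt.hasDerivAt

lemma contDiff_deriv (hf : Admissible K₀ K₁ M₀ L f) : ContDiff ℝ 2 (deriv f) :=
  ((contDiff_succ_iff_deriv (n := 2)).1 ((by norm_num : (2 : WithTop ℕ∞) + 1 = 3) ▸ hf.contDiff)).2.2

lemma continuous (hf : Admissible K₀ K₁ M₀ L f) : Continuous f := hf.contDiff.continuous

lemma abs_deriv_le (hf : Admissible K₀ K₁ M₀ L f) (x : ℝ) : |deriv f x| ≤ K₀ * L := by
  obtain ⟨k, hk⟩ := hf.lift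
  have := abs_le_supNorm hf.contDiff_deriv.continuous (deriv_periodic hk) x
  linarith [hf.h1, supNorm_nonneg (deriv (deriv f))]

lemma abs_deriv_sub_le (hf : Admissible K₀ K₁ M₀ L f) (x y : ℝ) :
    |deriv f x - deriv f y| ≤ K₀ * L * |x - y| := by
  obtain ⟨k, hk⟩ := hf.lift
  refine abs_sub_le_of_hasDerivAt (d := deriv (deriv f)) (fun z =>
    (hf.contDiff_deriv.differentiable (by norm_num)).differentiableAt.hasDerivAt) (fun z => ?_) x y
  have hp : Function.Periodic (deriv (deriv f)) 1 :=
    deriv_periodic (k := 0) fun x => by rw [deriv_periodic hk, add_zero]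
  have hc : Continuous (deriv (deriv f)) := hf.contDiff_deriv.continuous_deriv (by norm_num)
  linarith [abs_le_supNorm hc hp z, hf.h1, supNorm_nonneg (deriv f)]

lemma periodic_coe (hf : Admissible K₀ K₁ M₀ L f) :
    Function.Periodic (fun x => (f x : T1)) 1 := fun x => by
  obtain ⟨k, hk⟩ := hf.lift
  have : ((k : ℝ) : T1) = 0 := by
    rw [AddCircle.coe_eq_zero_iff]
    exact ⟨k, by simp⟩
  simp only [hk, AddCircle.coe_add, this, add_zero]

lemma coe_rep (hf : Admissible K₀ K₁ M₀ L f) (p : T1) :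
    (f (rep p) : T1) = hf.periodic_coe.lift p := by
  conv_rhs => rw [← AddCircle.coe_equivIco (p := (1 : ℝ)) (a := 0) (y := p)]
  rfl

lemma stdMap_coe (hf : Admissible K₀ K₁ M₀ L f) (x : ℝ) (q : T1) :
    stdMap f ((x : T1), q) = ((f x : T1) - q, (x : T1)) := by
  simp only [stdMap, hf.coe_rep]
  rfl

lemma continuous_coe_rep (hf : Admissible K₀ K₁ M₀ L f) :
    Continuous fun p : T1 => (f (rep p) : T1) := by
  simp only [hf.coe_rep]
  exact continuous_coinduced_dom.2 ((AddCircle.continuous_mk' 1).comp hf.continuous)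

lemma continuous_stdMap (hf : Admissible K₀ K₁ M₀ L f) : Continuous (stdMap f) :=
  ((hf.continuous_coe_rep.comp continuous_fst).sub continuous_snd).prodMk continuous_fst

lemma measurePreserving_stdMap (hf : Admissible K₀ K₁ M₀ L f) :
    MeasurePreserving (stdMap f) (volume : Measure T2) volume := by
  have h1 : MeasurePreserving (fun p : T1 × T1 => (p.1, (f (rep p.1) : T1) - p.2))
      ((volume : Measure T1).prod volume) ((volume : Measure T1).prod volume) := by
    refine MeasurePreserving.skew_product (g := fun a b => (f (rep a) : T1) - b)
      (MeasurePreserving.id _) ?_ ?_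
    · exact ((hf.continuous_coe_rep.comp continuous_fst).sub continuous_snd).measurable
    · exact Eventually.of_forall fun a => Measure.map_sub_left_eq_self _ _
  exact (Measure.measurePreserving_swap (μ := (volume : Measure T1)) (ν := volume)).comp h1

end Admissible

/-! ### One step of the dynamics -/

/-- Largeness threshold for `L ^ (1 / 4)`. -/
noncomputable def rootThreshold (K₀ K₁ : ℝ) : ℝ := 1 + 4 * K₁ + 64 * K₁ ^ 3 * (K₀ + 1)

/-- Coefficient of the loss in one step of the dynamics, which is this constant divided by
`L ^ (1 / 4)`. -/
noncomputable def lossConst (K₀ K₁ : ℝ) (M₀ : ℕ) : ℝ :=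
  64 * K₁ ^ 3 * (K₀ + 1) ^ 2 + 8 * K₁ + 4 * M₀

/-- Let `L = r ^ 4`, and cut a unit interval into `⌈r⌉` equal intervals. Those that stay at distance
`1 / ⌈r⌉` from the critical set are stretched over many turns of the circle, so that the image of
the curve consists, up to a proportion `O(1 / r)`, of full turns carrying almost uniform densities;
the others have total length `O(1 / r)`. -/
lemma sum_abs_integral_le {K₀ K₁ r : ℝ} {M₀ : ℕ} (hK₀ : 0 < K₀) (hK₁ : 0 < K₁)
    (hr : rootThreshold K₀ K₁ ≤ r) {f g g' : ℝ → ℝ} (hf : Admissible K₀ K₁ M₀ (r ^ 4) f)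
    (hg : IsCurve 1 g g') {Ψ : ℝ → ℝ → ℝ} (hΨ : Continuous fun p : ℝ × ℝ => Ψ p.1 p.2) {B S : ℝ}
    (hB : ∀ a b, |Ψ a b| ≤ B)
    (hS : ∀ w w' : ℝ → ℝ, IsCurve (4 * K₁ / r) w w' →
      ∀ c : ℝ, |∫ v in c..c + 1, Ψ v (w v)| ≤ S) (c : ℝ) :
    ∑ j ∈ Finset.range ⌈r⌉₊,
      |∫ x in (c + j / ⌈r⌉₊)..(c + (j + 1) / ⌈r⌉₊), Ψ (f x - g x) x|
      ≤ S + B * (lossConst K₀ K₁ M₀ / r) := by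
  have hr1 : 1 ≤ r := by
    have : 0 ≤ 4 * K₁ + 64 * K₁ ^ 3 * (K₀ + 1) := by positivity
    unfold rootThreshold at hr; linarith
  have hrK : 4 * K₁ ≤ r := by
    have : 0 ≤ 1 + 64 * K₁ ^ 3 * (K₀ + 1) := by positivity
    unfold rootThreshold at hr; linarith
  have hrK' : 64 * K₁ ^ 3 * (K₀ + 1) ≤ r := by
    unfold rootThreshold at hr; linarith
  have hr0 : 0 < r := by linarith
  set Q := ⌈r⌉₊ with hQdef
  have hrQ : r ≤ Q := Nat.le_ceil r
  have hQr : (Q : ℝ) ≤ 2 * r := by linarith [Nat.ceil_lt_add_one hr0.le]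
  have hQ0 : (0 : ℝ) < Q := by linarith
  have hQn : 0 < Q := by exact_mod_cast hQ0
  have hB0 : 0 ≤ B := (abs_nonneg _).trans (hB 0 0)
  set m := r ^ 3 / (4 * K₁) with hm
  have hm0 : 0 < m := by positivity
  set Λ := (K₀ + 1) * r ^ 4 with hΛ
  have hr4 : 1 ≤ r ^ 4 := one_le_pow₀ hr1
  have hr3 : r ≤ r ^ 3 := le_self_pow₀ hr1 (by norm_num)
  have hΛm : Λ ≤ m ^ 3 := by
    have h1 : 64 * K₁ ^ 3 * (K₀ + 1) ≤ r ^ 5 := hrK'.trans (le_self_pow₀ hr1 (by norm_num))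
    have h2 : m ^ 3 = r ^ 9 / (64 * K₁ ^ 3) := by rw [hm]; field_simp; norm_num
    rw [h2, le_div_iff₀ (by positivity), hΛ]
    calc (K₀ + 1) * r ^ 4 * (64 * K₁ ^ 3) = 64 * K₁ ^ 3 * (K₀ + 1) * r ^ 4 := by ring
      _ ≤ r ^ 5 * r ^ 4 := by gcongr
      _ = r ^ 9 := by ring
  have hslope : 1 / m ≤ 4 * K₁ / r := by
    have : 1 / m = 4 * K₁ / r ^ 3 := by rw [hm]; field_simp
    rw [this]
    gcongr
  have hS' : ∀ w w' : ℝ → ℝ, IsCurve (1 / m) w w' → ∀ c : ℝ, |∫ v in c..c + 1, Ψ v (w v)| ≤ S :=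
    fun w w' hw => hS w w' (hw.mono hslope)
  have hS0 : 0 ≤ S := by
    have h0 : IsCurve (4 * K₁ / r) (fun _ => (0 : ℝ)) (fun _ => 0) :=
      ⟨fun x => hasDerivAt_const x 0, fun x => by rw [abs_zero]; positivity, fun x y => by simp⟩
    exact (abs_nonneg _).trans (hS _ _ h0 0)
  set u : ℝ → ℝ := fun x => f x - g x
  set d : ℝ → ℝ := fun x => deriv f x - g' x
  have hu : ∀ x, HasDerivAt u (d x) x := fun x => (hf.hasDerivAt x).sub (hg.hasDerivAt x)
  have hdlip : ∀ x y, |d x - d y| ≤ Λ * |x - y| := fun x y => by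
    have h1 := hf.abs_deriv_sub_le x y
    have h2 := hg.slope_lip x y
    have h3 : d x - d y = (deriv f x - deriv f y) - (g' x - g' y) := by simp only [d]; ring
    rw [h3]
    refine (abs_sub _ _).trans ?_
    have h4 : |x - y| ≤ r ^ 4 * |x - y| := le_mul_of_one_le_left (abs_nonneg _) hr4
    rw [hΛ]; linarith
  have hdD : ∀ x, |d x| ≤ Λ := fun x => by
    have h1 := hf.abs_deriv_le x
    have h2 := hg.abs_slope_le x
    refine (abs_sub _ _).trans ?_
    rw [hΛ]; linarith
  classical
  set bad := (Finset.range Q).filter fun j : ℕ =>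
    ∃ x ∈ Set.Icc (c + (j : ℝ) / Q) (c + ((j : ℝ) + 1) / Q), ∃ z ∈ critSet f,
      dist (x : T1) z < 1 / Q with hbad
  have hcard : (bad.card : ℝ) ≤ 4 * M₀ :=
    card_close_intervals_le hf.h2.1 hf.h2.2 c hQn bad (Finset.filter_subset _ _)
      fun j hj => (Finset.mem_filter.1 hj).2
  set E := Λ / m ^ 3 * Λ with hE
  have hE0 : 0 ≤ E := by positivity
  have hone : ∀ j ∈ Finset.range Q,
      |∫ x in (c + j / Q)..(c + (j + 1) / Q), Ψ (u x) x|
        ≤ ((S + B * E) / Q + B / m) + if j ∈ bad then B / Q else 0 := by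
    intro j hj
    have hlen : c + ((j : ℝ) + 1) / Q - (c + j / Q) = 1 / Q := by ring
    have hle : c + (j : ℝ) / Q ≤ c + (j + 1) / Q := by
      have : (0 : ℝ) ≤ 1 / Q := by positivity
      linarith
    have hgood0 : 0 ≤ (S + B * E) / Q + B / m := by positivity
    split_ifs with hjb
    · have h1 := intervalIntegral.norm_integral_le_of_norm_le_const
        (a := c + (j : ℝ) / Q) (b := c + (j + 1) / Q) (f := fun x => Ψ (u x) x) (C := B)
        (fun x _ => hB _ _)
      rw [hlen, abs_of_pos (by positivity), Real.norm_eq_abs] at h1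
      have : B * (1 / Q) = B / Q := by ring
      linarith
    · rw [add_zero]
      have hd : ∀ x ∈ Set.Icc (c + (j : ℝ) / Q) (c + (j + 1) / Q), m ≤ |d x| := by
        intro x hx
        have hdist : 1 / (Q : ℝ) ≤ Metric.infDist (x : T1) (critSet f) := by
          by_contra! hcon
          obtain ⟨z, hz, hz'⟩ := (Metric.infDist_lt_iff hf.h3.1).1 hcon
          exact hjb (Finset.mem_filter.2 ⟨hj, x, hx, z, hz, hz'⟩)
        have h2 : 1 / (2 * r) ≤ Metric.infDist (x : T1) (critSet f) :=
          (one_div_le_one_div_of_le hQ0 hQr).trans hdist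
        have h3 : r ^ 4 * K₁⁻¹ * (1 / (2 * r)) ≤ |deriv f x| :=
          (mul_le_mul_of_nonneg_left h2 (by positivity)).trans (hf.h3.2 x)
        have h4 : r ^ 4 * K₁⁻¹ * (1 / (2 * r)) = m + m := by
          rw [hm]; field_simp; norm_num
        have h5 : 1 ≤ m := by
          rw [hm, le_div_iff₀ (by positivity)]; linarith
        have h6 := abs_sub_abs_le_abs_sub (deriv f x) (g' x)
        have h7 := hg.abs_slope_le x
        simp only [d]; linarith
      have h := abs_integral_le_of_le_abs_deriv_on hΨ hle hm0 hu hd hdlip hΛm hdD hB hS'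
      rw [hlen] at h
      refine h.trans (le_of_eq ?_)
      rw [hE]; ring
  refine (Finset.sum_le_sum hone).trans ?_
  rw [Finset.sum_add_distrib, Finset.sum_const, Finset.card_range, nsmul_eq_mul,
    ← Finset.sum_filter]
  have hfil : (Finset.range Q).filter (fun j => j ∈ bad) = bad := by
    ext j; simp only [Finset.mem_filter]; exact ⟨fun h => h.2, fun h =>
      ⟨Finset.filter_subset _ _ h, h⟩⟩
  rw [hfil, Finset.sum_const, nsmul_eq_mul]
  have e1 : E = 64 * K₁ ^ 3 * (K₀ + 1) ^ 2 / r := by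
    rw [hE, hΛ, hm]; field_simp; norm_num
  have e2 : (Q : ℝ) * ((S + B * E) / Q + B / m) = S + B * (E + Q / m) := by
    field_simp; ring
  have e3 : (Q : ℝ) / m ≤ 8 * K₁ / r := by
    have : 8 * K₁ / r = (8 * K₁ / r * m) / m := by field_simp
    rw [this]
    gcongr
    have : 8 * K₁ / r * m = 2 * r ^ 2 := by rw [hm]; field_simp; norm_num
    rw [this]
    nlinarith
  have e4 : (bad.card : ℝ) * (B / Q) ≤ B * (4 * M₀ / r) := by
    have h1 : (bad.card : ℝ) * (B / Q) ≤ 4 * M₀ * (B / r) := by gcongr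
    refine h1.trans (le_of_eq ?_); ring
  rw [e2]
  have e5 : B * (E + Q / m) ≤ B * (64 * K₁ ^ 3 * (K₀ + 1) ^ 2 / r + 8 * K₁ / r) := by
    rw [← e1]; gcongr
  have e6 : lossConst K₀ K₁ M₀ / r
      = 64 * K₁ ^ 3 * (K₀ + 1) ^ 2 / r + 8 * K₁ / r + 4 * M₀ / r := by
    unfold lossConst; ring
  rw [e6]; linarith [mul_add B (64 * K₁ ^ 3 * (K₀ + 1) ^ 2 / r + 8 * K₁ / r) (4 * M₀ / r)]

/-! ### Hölder observables -/

/-- `φ` is `α`-Hölder on the flat torus with the nonnegative constant `C`. -/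
structure HolderBound (C α : ℝ) (φ : T2 → ℝ) : Prop where
  nonneg : 0 ≤ C
  bound : ∀ p q : T2, |φ p - φ q| ≤ C * torusDist p q ^ α

lemma torusDist_nonneg (p q : T2) : 0 ≤ torusDist p q := Real.sqrt_nonneg _

lemma IsHolder.exists_holderBound {α : ℝ} {φ : T2 → ℝ} (h : IsHolder α φ) :
    ∃ C, HolderBound C α φ := by
  obtain ⟨C, hC⟩ := h
  refine ⟨|C|, abs_nonneg _, fun p q => (hC p q).trans ?_⟩
  exact mul_le_mul_of_nonneg_right (le_abs_self C) (Real.rpow_nonneg (torusDist_nonneg p q) α)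

namespace HolderBound

variable {C α : ℝ} {φ : T2 → ℝ}

lemma abs_sub_fst_le (h : HolderBound C α φ) (a a' b : T1) :
    |φ (a, b) - φ (a', b)| ≤ C * dist a a' ^ α := by
  simpa [torusDist, Real.sqrt_sq dist_nonneg] using h.bound (a, b) (a', b)

lemma abs_sub_snd_le (h : HolderBound C α φ) (a b b' : T1) :
    |φ (a, b) - φ (a, b')| ≤ C * dist b b' ^ α := by
  simpa [torusDist, Real.sqrt_sq dist_nonneg] using h.bound (a, b) (a, b')

lemma continuous (h : HolderBound C α φ) (hα : 0 < α) : Continuous φ := by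
  refine continuous_iff_continuousAt.2 fun q => ?_
  rw [ContinuousAt, tendsto_iff_dist_tendsto_zero]
  have h1 : Continuous fun p : T2 => C * torusDist p q ^ α := by
    have : Continuous fun p : T2 => torusDist p q := by unfold torusDist; fun_prop
    exact continuous_const.mul (this.rpow_const fun _ => Or.inr hα.le)
  have h2 := h1.tendsto q
  have h3 : torusDist q q = 0 := by simp [torusDist]
  rw [h3, Real.zero_rpow hα.ne', mul_zero] at h2
  exact squeeze_zero (fun _ => dist_nonneg) (fun p => h.bound p q) h2

end HolderBound

/-- The average of `φ` over the first coordinate, as a function of the second. -/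
noncomputable def fstAverage (φ : T2 → ℝ) (b : T1) : ℝ := ∫ a : T1, φ (a, b)

lemma continuous_fstAverage {φ : T2 → ℝ} (hφ : Continuous φ) : Continuous (fstAverage φ) := by
  have := continuous_parametric_integral_of_continuous (μ := (volume : Measure T1))
    (f := fun b a => φ (a, b)) (hφ.comp (continuous_snd.prodMk continuous_fst)) isCompact_univ
  simp only [Measure.restrict_univ] at this
  exact this

lemma integrable_of_continuous {X : Type*} [TopologicalSpace X] [CompactSpace X]
    [MeasurableSpace X] [OpensMeasurableSpace X] {μ : Measure X} [IsFiniteMeasure μ] {φ : X → ℝ}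
    (hφ : Continuous φ) : Integrable φ μ := by
  exact hφ.integrable_of_hasCompactSupport (HasCompactSupport.of_compactSpace φ)

lemma integral_fstAverage {φ : T2 → ℝ} (hφ : Continuous φ) :
    ∫ b, fstAverage φ b = ∫ p, φ p :=
  (integral_prod_symm φ (integrable_of_continuous (μ := (volume : Measure T2)) hφ)).symm

lemma abs_fstAverage_le {φ : T2 → ℝ} {B : ℝ} (hB : ∀ p, |φ p| ≤ B) (b : T1) :
    |fstAverage φ b| ≤ B := by
  have := norm_integral_le_of_norm_le_const (μ := (volume : Measure T1)) (f := fun a => φ (a, b))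
    (C := B) (Eventually.of_forall fun a => hB _)
  simpa [fstAverage] using this

lemma HolderBound.abs_fstAverage_sub_le {C α : ℝ} {φ : T2 → ℝ} (h : HolderBound C α φ)
    (hα : 0 < α) (b b' : T1) : |fstAverage φ b - fstAverage φ b'| ≤ C * dist b b' ^ α := by
  have hc := h.continuous hα
  have hi : ∀ b : T1, Integrable (fun a : T1 => φ (a, b)) := fun b =>
    integrable_of_continuous (hc.comp (continuous_id.prodMk continuous_const))
  have h1 : fstAverage φ b - fstAverage φ b' = ∫ a : T1, (φ (a, b) - φ (a, b')) :=
    (integral_sub (hi b) (hi b')).symm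
  have := norm_integral_le_of_norm_le_const (μ := (volume : Measure T1))
    (f := fun a => φ (a, b) - φ (a, b')) (C := C * dist b b' ^ α)
    (Eventually.of_forall fun a => h.abs_sub_snd_le a b b')
  rw [h1]
  simpa using this

/-! ### Integrals of observables along curves -/

lemma integral_unit_eq_sum {h : ℝ → ℝ} (hh : Continuous h) (c : ℝ) {Q : ℕ} (hQ : 0 < Q) :
    ∫ x in c..c + 1, h x
      = ∑ j ∈ Finset.range Q, ∫ x in (c + j / Q)..(c + (j + 1) / Q), h x := by
  have := intervalIntegral.sum_integral_adjacent_intervals (f := h) (μ := volume)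
    (a := fun k : ℕ => c + (k : ℝ) / Q) (n := Q) fun k _ => hh.intervalIntegrable _ _
  have hQ' : (Q : ℝ) ≠ 0 := by exact_mod_cast hQ.ne'
  simp only [Nat.cast_zero, zero_div, add_zero, div_self hQ', Nat.cast_add, Nat.cast_one] at this
  exact this.symm

lemma one_le_rootThreshold {K₀ K₁ : ℝ} (hK₀ : 0 < K₀) (hK₁ : 0 < K₁) : 1 ≤ rootThreshold K₀ K₁ := by
  unfold rootThreshold
  have : 0 ≤ 4 * K₁ + 64 * K₁ ^ 3 * (K₀ + 1) := by positivity
  linarith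

lemma slope_le_one {K₀ K₁ r : ℝ} (hK₀ : 0 < K₀) (hK₁ : 0 < K₁) (hr : rootThreshold K₀ K₁ ≤ r) :
    4 * K₁ / r ≤ 1 := by
  have h1 := (one_le_rootThreshold hK₀ hK₁).trans hr
  rw [div_le_one (by linarith)]
  have : 0 ≤ 1 + 64 * K₁ ^ 3 * (K₀ + 1) := by positivity
  unfold rootThreshold at hr; linarith

lemma lossConst_nonneg {K₀ K₁ : ℝ} (hK₀ : 0 < K₀) (hK₁ : 0 < K₁) (M₀ : ℕ) :
    0 ≤ lossConst K₀ K₁ M₀ := by unfold lossConst; positivity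

lemma one_div_le_rpow_neg {r α : ℝ} (hr : 1 ≤ r) (hα : α ≤ 1) : 1 / r ≤ r ^ (-α) := by
  rw [one_div, ← Real.rpow_neg_one]
  exact Real.rpow_le_rpow_of_exponent_le hr (by linarith)

lemma Admissible.stdMap_curve {K₀ K₁ L : ℝ} {M₀ : ℕ} {f : ℝ → ℝ} (hf : Admissible K₀ K₁ M₀ L f)
    (x y : ℝ) : stdMap f ((x : T1), (y : T1)) = (((f x - y : ℝ) : T1), (x : T1)) := by
  rw [hf.stdMap_coe, AddCircle.coe_sub]

lemma continuous_comp_coe {Φ : T2 → ℝ} (hΦ : Continuous Φ) :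
    Continuous fun p : ℝ × ℝ => Φ ((p.1 : T1), (p.2 : T1)) :=
  hΦ.comp (((AddCircle.continuous_mk' 1).comp continuous_fst).prodMk
    ((AddCircle.continuous_mk' 1).comp continuous_snd))

/-- Coefficient in the decay of integrals of an observable along curves. -/
noncomputable def curveConst (K₀ K₁ : ℝ) (M₀ : ℕ) (α C B : ℝ) : ℝ :=
  2 * C * (4 * K₁) ^ α + 2 * B * lossConst K₀ K₁ M₀

/-- One step of the dynamics averages `φ` along any curve: subtracting from `φ` its average over the
first coordinate leaves an observable whose integrals along nearly horizontal unit curves are small,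
and that average integrates to zero because the curve is parametrized by Lebesgue measure. -/
lemma abs_integral_stdMap_curve_le {K₀ K₁ r α C B : ℝ} {M₀ : ℕ} (hK₀ : 0 < K₀) (hK₁ : 0 < K₁)
    (hα0 : 0 < α) (hα1 : α ≤ 1) (hr : rootThreshold K₀ K₁ ≤ r) {f g g' : ℝ → ℝ}
    (hf : Admissible K₀ K₁ M₀ (r ^ 4) f) (hg : IsCurve 1 g g') {φ : T2 → ℝ}
    (hφ : HolderBound C α φ) (hB : ∀ p, |φ p| ≤ B) (h0 : ∫ p, φ p = 0) (c : ℝ) :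
    |∫ x in c..c + 1, φ (stdMap f ((x : T1), (g x : T1)))|
      ≤ curveConst K₀ K₁ M₀ α C B * r ^ (-α) := by
  have hφc := hφ.continuous hα0
  have hr1 : 1 ≤ r := (one_le_rootThreshold hK₀ hK₁).trans hr
  have hC := hφ.nonneg
  have hB0 : 0 ≤ B := (abs_nonneg _).trans (hB 0)
  set θ := 4 * K₁ / r with hθ
  have hθ0 : 0 ≤ θ := by positivity
  set Φ : T2 → ℝ := fun p => φ p - fstAverage φ p.2 with hΦ
  have hΦc : Continuous Φ := hφc.sub ((continuous_fstAverage hφc).comp continuous_snd)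
  have hΨ := continuous_comp_coe hΦc
  have hQ : 0 < ⌈r⌉₊ := Nat.ceil_pos.2 (by linarith)
  have hmain := sum_abs_integral_le (B := 2 * B) (S := 2 * C * θ ^ α) hK₀ hK₁ hr hf hg
    (Ψ := fun a b => Φ ((a : T1), (b : T1))) hΨ
    (fun a b => by
      refine (abs_sub _ _).trans ?_
      linarith [hB ((a : T1), (b : T1)), abs_fstAverage_le hB (b : T1)])
    (fun w w' hw e => by
      have hwc := hw.continuous
      have hzero : ∫ v in e..e + 1, Φ ((v : T1), (w e : T1)) = 0 := by
        have h1 := UnitAddCircle.intervalIntegral_preimage e (fun a : T1 => Φ (a, (w e : T1)))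
        rw [h1]
        simp only [hΦ]
        have h2 : Integrable (fun a : T1 => φ (a, (w e : T1))) :=
          integrable_of_continuous (hφc.comp (continuous_id.prodMk continuous_const))
        rw [integral_sub h2 (integrable_const _)]
        simp [fstAverage]
      have hcont1 : Continuous fun v : ℝ => Φ ((v : T1), (w v : T1)) :=
        hΨ.comp (continuous_id.prodMk hwc)
      have hcont2 : Continuous fun v : ℝ => Φ ((v : T1), (w e : T1)) :=
        hΨ.comp (continuous_id.prodMk continuous_const)
      have h2 : ∫ v in e..e + 1, Φ ((v : T1), (w v : T1))
          = ∫ v in e..e + 1, (Φ ((v : T1), (w v : T1)) - Φ ((v : T1), (w e : T1))) := by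
        rw [intervalIntegral.integral_sub (hcont1.intervalIntegrable _ _)
          (hcont2.intervalIntegrable _ _), hzero, sub_zero]
      rw [h2]
      have h3 := intervalIntegral.norm_integral_le_of_norm_le_const (a := e) (b := e + 1)
        (f := fun v => Φ ((v : T1), (w v : T1)) - Φ ((v : T1), (w e : T1)))
        (C := 2 * C * θ ^ α) (fun v hv => by
          rw [Set.uIoc_of_le (by linarith)] at hv
          have h4 : dist (w v : T1) (w e : T1) ≤ θ := by
            refine (dist_coe_le _ _).trans ((hw.abs_sub_le v e).trans ?_)
            refine mul_le_of_le_one_right hθ0 ?_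
            rw [abs_le]; constructor <;> linarith [hv.1, hv.2]
          have h5 : dist (w v : T1) (w e : T1) ^ α ≤ θ ^ α :=
            Real.rpow_le_rpow dist_nonneg h4 hα0.le
          have h6 := hφ.abs_sub_snd_le (v : T1) (w v : T1) (w e : T1)
          have h7 := hφ.abs_fstAverage_sub_le hα0 (w v : T1) (w e : T1)
          have h8 : Φ ((v : T1), (w v : T1)) - Φ ((v : T1), (w e : T1))
              = (φ ((v : T1), (w v : T1)) - φ ((v : T1), (w e : T1)))
                - (fstAverage φ (w v : T1) - fstAverage φ (w e : T1)) := by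
            simp only [hΦ]; ring
          rw [h8, Real.norm_eq_abs]
          refine (abs_sub _ _).trans ?_
          have h9 : C * dist (w v : T1) (w e : T1) ^ α ≤ C * θ ^ α :=
            mul_le_mul_of_nonneg_left h5 hC
          linarith)
      simpa using h3) c
  have hcu : Continuous fun x : ℝ => Φ (((f x - g x : ℝ) : T1), (x : T1)) :=
    hΨ.comp ((hf.continuous.sub hg.continuous).prodMk continuous_id)
  have havg : ∫ x in c..c + 1, fstAverage φ (x : T1) = 0 := by
    rw [UnitAddCircle.intervalIntegral_preimage c (fstAverage φ), integral_fstAverage hφc, h0]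
  have hsplit : ∫ x in c..c + 1, φ (stdMap f ((x : T1), (g x : T1)))
      = ∫ x in c..c + 1, Φ (((f x - g x : ℝ) : T1), (x : T1)) := by
    have hca : Continuous fun x : ℝ => fstAverage φ (x : T1) :=
      (continuous_fstAverage hφc).comp (AddCircle.continuous_mk' 1)
    have h1 : ∀ x : ℝ, φ (stdMap f ((x : T1), (g x : T1)))
        = Φ (((f x - g x : ℝ) : T1), (x : T1)) + fstAverage φ (x : T1) := fun x => by
      rw [hf.stdMap_curve]; simp [hΦ]
    simp only [h1]
    rw [intervalIntegral.integral_add (hcu.intervalIntegrable _ _) (hca.intervalIntegrable _ _),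
      havg, add_zero]
  rw [hsplit, integral_unit_eq_sum hcu c hQ]
  refine (Finset.abs_sum_le_sum_abs _ _).trans (hmain.trans ?_)
  have e1 : θ ^ α = (4 * K₁) ^ α * r ^ (-α) := by
    rw [hθ, Real.div_rpow (by positivity) (by linarith), Real.rpow_neg (by linarith),
      div_eq_mul_inv]
  have e2 : 2 * B * (lossConst K₀ K₁ M₀ / r) ≤ 2 * B * (lossConst K₀ K₁ M₀ * r ^ (-α)) := by
    rw [div_eq_mul_one_div]
    have := one_div_le_rpow_neg hr1 hα1
    have := lossConst_nonneg hK₀ hK₁ M₀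
    gcongr
  rw [e1]; unfold curveConst; linarith

/-! ### Compositions -/

lemma compMap_add (f : ℕ → ℝ → ℝ) (i n : ℕ) :
    compMap f (i + n) = compMap (fun k => f (k + i)) n ∘ compMap f i := by
  induction n with
  | zero => rfl
  | succ n ih =>
    rw [← add_assoc]
    simp only [compMap, ih, Function.comp_assoc]
    rw [show i + n + 1 = n + 1 + i by ring]

lemma compMap_succ_front (f : ℕ → ℝ → ℝ) (n : ℕ) :
    compMap f (n + 1) = compMap (fun k => f (k + 1)) n ∘ stdMap (f 1) := by
  rw [add_comm n 1, compMap_add]; rfl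

/-- The maps `f 1, f 2, …` are admissible with coefficients `r n ^ 4` above the threshold. -/
def AdmissibleSeq (K₀ K₁ : ℝ) (M₀ : ℕ) (r : ℕ → ℝ) (f : ℕ → ℝ → ℝ) : Prop :=
  ∀ n, 1 ≤ n → rootThreshold K₀ K₁ ≤ r n ∧ Admissible K₀ K₁ M₀ (r n ^ 4) (f n)

lemma AdmissibleSeq.shift {K₀ K₁ : ℝ} {M₀ : ℕ} {r : ℕ → ℝ} {f : ℕ → ℝ → ℝ}
    (h : AdmissibleSeq K₀ K₁ M₀ r f) (i : ℕ) :
    AdmissibleSeq K₀ K₁ M₀ (fun k => r (k + i)) (fun k => f (k + i)) :=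
  fun n hn => h (n + i) (by omega)

lemma AdmissibleSeq.continuous_compMap {K₀ K₁ : ℝ} {M₀ : ℕ} {r : ℕ → ℝ} {f : ℕ → ℝ → ℝ}
    (h : AdmissibleSeq K₀ K₁ M₀ r f) (n : ℕ) : Continuous (compMap f n) := by
  induction n with
  | zero => exact continuous_id
  | succ n ih => exact (h (n + 1) (by omega)).2.continuous_stdMap.comp ih

lemma AdmissibleSeq.measurePreserving_compMap {K₀ K₁ : ℝ} {M₀ : ℕ} {r : ℕ → ℝ} {f : ℕ → ℝ → ℝ}
    (h : AdmissibleSeq K₀ K₁ M₀ r f) (n : ℕ) :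
    MeasurePreserving (compMap f n) (volume : Measure T2) volume := by
  induction n with
  | zero => exact MeasurePreserving.id _
  | succ n ih => exact (h (n + 1) (by omega)).2.measurePreserving_stdMap.comp ih

/-- Integrals of `φ ∘ Fⁿ` along curves: the first `n - 1` steps reproduce full turns of the circle
up to summable losses, and the last one averages `φ`. -/
lemma abs_integral_compMap_curve_le {K₀ K₁ α C B : ℝ} {M₀ : ℕ} (hK₀ : 0 < K₀) (hK₁ : 0 < K₁)
    (hα0 : 0 < α) (hα1 : α ≤ 1) {φ : T2 → ℝ} (hφ : HolderBound C α φ) (hB : ∀ p, |φ p| ≤ B)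
    (h0 : ∫ p, φ p = 0) (n : ℕ) {r : ℕ → ℝ} {f : ℕ → ℝ → ℝ} (hf : AdmissibleSeq K₀ K₁ M₀ r f)
    {g g' : ℝ → ℝ} (hg : IsCurve 1 g g') (c : ℝ) :
    |∫ x in c..c + 1, φ (compMap f (n + 1) ((x : T1), (g x : T1)))|
      ≤ curveConst K₀ K₁ M₀ α C B * ∑ k ∈ Finset.range (n + 1), r (k + 1) ^ (-α) := by
  have hφc := hφ.continuous hα0
  have hC := hφ.nonneg
  have hB0 : 0 ≤ B := (abs_nonneg _).trans (hB 0)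
  induction n generalizing r f g g' c with
  | zero =>
    obtain ⟨hr, hf1⟩ := hf 1 le_rfl
    simpa [compMap] using abs_integral_stdMap_curve_le hK₀ hK₁ hα0 hα1 hr hf1 hg hφ hB h0 c
  | succ n ih =>
    obtain ⟨hr, hf1⟩ := hf 1 le_rfl
    have hr1 : 1 ≤ r 1 := (one_le_rootThreshold hK₀ hK₁).trans hr
    have hf' := hf.shift 1
    have hQ : 0 < ⌈r 1⌉₊ := Nat.ceil_pos.2 (by linarith)
    have hΨ := continuous_comp_coe (hφc.comp (hf'.continuous_compMap (n + 1)))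
    have hmain := sum_abs_integral_le hK₀ hK₁ hr hf1 hg
      (Ψ := fun a b => φ (compMap (fun k => f (k + 1)) (n + 1) ((a : T1), (b : T1)))) hΨ
      (fun a b => hB _) (fun w w' hw e => ih hf' (hw.mono (slope_le_one hK₀ hK₁ hr)) e) c
    have hstep : ∀ x : ℝ, φ (compMap f (n + 1 + 1) ((x : T1), (g x : T1)))
        = φ (compMap (fun k => f (k + 1)) (n + 1) (((f 1 x - g x : ℝ) : T1), (x : T1))) :=
      fun x => by rw [compMap_succ_front, Function.comp, hf1.stdMap_curve]
    simp only [hstep]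
    rw [integral_unit_eq_sum (h := fun x : ℝ => φ (compMap (fun k => f (k + 1)) (n + 1)
      (((f 1 x - g x : ℝ) : T1), (x : T1))))
      (hΨ.comp ((hf1.continuous.sub hg.continuous).prodMk continuous_id)) c hQ]
    refine (Finset.abs_sum_le_sum_abs _ _).trans (hmain.trans ?_)
    rw [Finset.sum_range_succ' _ (n + 1), mul_add]
    refine add_le_add_right ?_ _
    have h1 := one_div_le_rpow_neg hr1 hα1
    have h2 := lossConst_nonneg hK₀ hK₁ M₀
    have h3 : 0 ≤ r 1 ^ (-α) := Real.rpow_nonneg (by linarith) _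
    calc B * (lossConst K₀ K₁ M₀ / r 1) ≤ B * (lossConst K₀ K₁ M₀ * r 1 ^ (-α)) := by
          rw [div_eq_mul_one_div]; gcongr
      _ = B * lossConst K₀ K₁ M₀ * r 1 ^ (-α) := by ring
      _ ≤ curveConst K₀ K₁ M₀ α C B * r (0 + 1) ^ (-α) := by
          refine mul_le_mul_of_nonneg_right ?_ h3
          have h4 : 0 ≤ 2 * C * (4 * K₁) ^ α := by positivity
          have h5 : 0 ≤ B * lossConst K₀ K₁ M₀ := by positivity
          unfold curveConst; linarith

/-- Decay of correlations with the initial observable, which is frozen on the intervals of the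
partition used in the first step. At least two steps are needed: after one step the second
coordinate of the image still is the first coordinate of the initial point. -/
lemma abs_correlation_le {K₀ K₁ α C B : ℝ} {M₀ : ℕ} (hK₀ : 0 < K₀) (hK₁ : 0 < K₁)
    (hα0 : 0 < α) (hα1 : α ≤ 1) {φ : T2 → ℝ} (hφ : HolderBound C α φ) (hB : ∀ p, |φ p| ≤ B)
    (h0 : ∫ p, φ p = 0) (n : ℕ) {r : ℕ → ℝ} {f : ℕ → ℝ → ℝ} (hf : AdmissibleSeq K₀ K₁ M₀ r f) :
    |∫ p, φ p * φ (compMap f (n + 2) p)|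
      ≤ B * (curveConst K₀ K₁ M₀ α C B + C) * ∑ k ∈ Finset.range (n + 2), r (k + 1) ^ (-α) := by
  have hφc := hφ.continuous hα0
  have hC := hφ.nonneg
  have hB0 : 0 ≤ B := (abs_nonneg _).trans (hB 0)
  obtain ⟨hr, hf1⟩ := hf 1 le_rfl
  have hr1 : 1 ≤ r 1 := (one_le_rootThreshold hK₀ hK₁).trans hr
  have hf' := hf.shift 1
  set Q := ⌈r 1⌉₊ with hQdef
  have hQ : 0 < Q := Nat.ceil_pos.2 (by linarith)
  have hQ0 : (0 : ℝ) < Q := by exact_mod_cast hQ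
  have hrQ : r 1 ≤ Q := Nat.le_ceil _
  have hΨ := continuous_comp_coe (hφc.comp (hf'.continuous_compMap (n + 1)))
  set A := curveConst K₀ K₁ M₀ α C B with hA
  have hA0 : 0 ≤ A := by
    have := lossConst_nonneg hK₀ hK₁ M₀
    rw [hA]; unfold curveConst; positivity
  set κ := r 1 ^ (-α) with hκ
  set S := A * ∑ k ∈ Finset.range (n + 1), r (k + 1 + 1) ^ (-α) with hS
  have hcomp : Continuous fun p => φ p * φ (compMap f (n + 2) p) :=
    hφc.mul (hφc.comp (hf.continuous_compMap _))
  have hfib : ∀ y : T1, ‖∫ a : T1, φ (a, y) * φ (compMap f (n + 2) (a, y))‖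
      ≤ B * (S + A * κ) + B * C * κ := by
    intro y
    obtain ⟨y₀, rfl⟩ := QuotientAddGroup.mk_surjective y
    have h1 := UnitAddCircle.intervalIntegral_preimage 0
      (fun a : T1 => φ (a, (y₀ : T1)) * φ (compMap f (n + 2) (a, (y₀ : T1))))
    rw [← h1]
    have hstep : ∀ x : ℝ, φ (compMap f (n + 2) ((x : T1), (y₀ : T1)))
        = φ (compMap (fun k => f (k + 1)) (n + 1) (((f 1 x - y₀ : ℝ) : T1), (x : T1))) :=
      fun x => by rw [compMap_succ_front, Function.comp, hf1.stdMap_curve]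
    set ψ : ℝ → ℝ := fun x =>
      φ (compMap (fun k => f (k + 1)) (n + 1) (((f 1 x - y₀ : ℝ) : T1), (x : T1))) with hψ
    set χ : ℝ → ℝ := fun x => φ ((x : T1), (y₀ : T1)) with hχ
    have hψc : Continuous ψ :=
      hΨ.comp ((hf1.continuous.sub continuous_const).prodMk continuous_id)
    have hχc : Continuous χ :=
      (continuous_comp_coe hφc).comp (continuous_id.prodMk continuous_const)
    simp only [hstep]
    change ‖∫ x in (0 : ℝ)..0 + 1, χ x * ψ x‖ ≤ _
    rw [integral_unit_eq_sum (h := fun x => χ x * ψ x) (hχc.mul hψc) 0 hQ, Real.norm_eq_abs]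
    have hmain := sum_abs_integral_le hK₀ hK₁ hr hf1 (IsCurve.const y₀)
      (Ψ := fun a b => φ (compMap (fun k => f (k + 1)) (n + 1) ((a : T1), (b : T1)))) hΨ
      (fun a b => hB _) (fun w w' hw e => abs_integral_compMap_curve_le hK₀ hK₁ hα0 hα1 hφ hB h0 n hf'
        (hw.mono (slope_le_one hK₀ hK₁ hr)) e) 0
    have hpiece : ∀ j ∈ Finset.range Q,
        |∫ x in (0 + (j : ℝ) / Q)..(0 + (j + 1) / Q), χ x * ψ x|
          ≤ B * |∫ x in (0 + (j : ℝ) / Q)..(0 + (j + 1) / Q), ψ x| + C * κ * B / Q := by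
      intro j _
      set s : ℝ := 0 + (j : ℝ) / Q with hs
      set t : ℝ := 0 + ((j : ℝ) + 1) / Q with ht
      have hts : t - s = 1 / Q := by rw [hs, ht]; ring
      have hst : s ≤ t := by
        have : (0 : ℝ) ≤ 1 / Q := by positivity
        linarith
      have h2 : ∫ x in s..t, χ x * ψ x
          = χ s * (∫ x in s..t, ψ x) + ∫ x in s..t, (χ x - χ s) * ψ x := by
        rw [← intervalIntegral.integral_const_mul, ← intervalIntegral.integral_add]
        · congr 1; ext x; ring
        · exact (hψc.const_mul _).intervalIntegrable _ _
        · exact ((hχc.sub continuous_const).mul hψc).intervalIntegrable _ _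
      have h3 := intervalIntegral.norm_integral_le_of_norm_le_const (a := s) (b := t)
        (f := fun x => (χ x - χ s) * ψ x) (C := C * κ * B) (fun x hx => by
          rw [Set.uIoc_of_le hst] at hx
          have h4 : dist (x : T1) (s : T1) ≤ (r 1)⁻¹ := by
            refine (dist_coe_le x s).trans ?_
            rw [abs_of_pos (by linarith [hx.1])]
            have : 1 / (Q : ℝ) ≤ 1 / r 1 := one_div_le_one_div_of_le (by linarith) hrQ
            rw [one_div (r 1)] at this
            linarith [hx.2]
          have h5 : dist (x : T1) (s : T1) ^ α ≤ κ := by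
            rw [hκ, Real.rpow_neg (by linarith), ← Real.inv_rpow (by linarith)]
            exact Real.rpow_le_rpow dist_nonneg h4 hα0.le
          rw [Real.norm_eq_abs, abs_mul]
          refine mul_le_mul ?_ (hB _) (abs_nonneg _) (by positivity)
          exact (hφ.abs_sub_fst_le _ _ _).trans (mul_le_mul_of_nonneg_left h5 hC))
      rw [hts, abs_of_pos (by positivity), Real.norm_eq_abs] at h3
      rw [h2]
      refine (abs_add_le _ _).trans (add_le_add ?_ (h3.trans (le_of_eq (by ring))))
      rw [abs_mul]
      exact mul_le_mul_of_nonneg_right (hB _) (abs_nonneg _)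
    refine (Finset.abs_sum_le_sum_abs _ _).trans ((Finset.sum_le_sum hpiece).trans ?_)
    rw [Finset.sum_add_distrib, ← Finset.mul_sum, Finset.sum_const, Finset.card_range,
      nsmul_eq_mul]
    have h6 : (Q : ℝ) * (C * κ * B / Q) = B * C * κ := by field_simp
    rw [h6]
    refine add_le_add_left (mul_le_mul_of_nonneg_left (hmain.trans ?_) hB0) _
    refine add_le_add_right ?_ _
    have h7 := one_div_le_rpow_neg hr1 hα1
    have h8 := lossConst_nonneg hK₀ hK₁ M₀
    have h9 : 0 ≤ κ := Real.rpow_nonneg (by linarith) _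
    calc B * (lossConst K₀ K₁ M₀ / r 1) ≤ B * (lossConst K₀ K₁ M₀ * κ) := by
          rw [div_eq_mul_one_div]; gcongr
      _ = B * lossConst K₀ K₁ M₀ * κ := by ring
      _ ≤ A * κ := by
          refine mul_le_mul_of_nonneg_right ?_ h9
          have h10 : 0 ≤ 2 * C * (4 * K₁) ^ α := by positivity
          have h11 : 0 ≤ B * lossConst K₀ K₁ M₀ := by positivity
          rw [hA]; unfold curveConst; linarith
  have hprod : ∫ p, φ p * φ (compMap f (n + 2) p)
      = ∫ y : T1, ∫ a : T1, φ (a, y) * φ (compMap f (n + 2) (a, y)) :=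
    integral_prod_symm _ (integrable_of_continuous (μ := (volume : Measure T2)) hcomp)
  rw [hprod]
  have h12 := norm_integral_le_of_norm_le_const (μ := (volume : Measure T1))
    (Eventually.of_forall hfib)
  rw [Real.norm_eq_abs] at h12
  refine h12.trans ?_
  rw [probReal_univ, mul_one, Finset.sum_range_succ' _ (n + 1)]
  have h13 : 0 ≤ ∑ k ∈ Finset.range (n + 1), r (k + 1 + 1) ^ (-α) :=
    Finset.sum_nonneg fun k _ => Real.rpow_nonneg
      (by linarith [(hf (k + 1 + 1) (by omega)).1, one_le_rootThreshold hK₀ hK₁]) _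
  have h14 : 0 ≤ B * C * ∑ k ∈ Finset.range (n + 1), r (k + 1 + 1) ^ (-α) := by positivity
  simp only [zero_add]
  rw [← hκ, hS]
  linarith

/-! ### Laws of large numbers for weakly correlated sequences -/

lemma sum_one_div_le_sqrt (n : ℕ) :
    ∑ i ∈ Finset.range n, (1 : ℝ) / (i + 1) ≤ 2 * Real.sqrt n := by
  induction n with
  | zero => simp
  | succ n ih =>
    rw [Finset.sum_range_succ]
    push_cast
    set a := Real.sqrt n
    set b := Real.sqrt (n + 1)
    have ha : 0 ≤ a := Real.sqrt_nonneg _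
    have ha2 : a ^ 2 = n := Real.sq_sqrt (by positivity)
    have hb2 : b ^ 2 = n + 1 := Real.sq_sqrt (by positivity)
    have hb : 1 ≤ b := Real.one_le_sqrt.2 (by linarith [Nat.cast_nonneg (α := ℝ) n])
    have hab : a ≤ b := Real.sqrt_le_sqrt (by linarith)
    have h1 : (1 : ℝ) / (n + 1) ≤ 2 * (b - a) := by
      rw [← hb2, div_le_iff₀ (by positivity)]
      have h2 : (b - a) * (b + a) = 1 := by nlinarith
      have h3 : 0 ≤ b - a := sub_nonneg.2 hab
      have h4 : b + a ≤ 2 * b ^ 2 := by nlinarith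
      calc (1 : ℝ) = (b - a) * (b + a) := h2.symm
        _ ≤ (b - a) * (2 * b ^ 2) := by gcongr
        _ = 2 * (b - a) * b ^ 2 := by ring
    linarith

lemma sum_one_div_sq_le (a : ℝ) (ha : 1 ≤ a) (n : ℕ) :
    ∑ k ∈ Finset.range n, 1 / (a + k) ^ 2 ≤ 2 / a := by
  have h : ∑ k ∈ Finset.range n, 1 / (a + k) ^ 2 ≤ 2 / a - 2 / (a + n) := by
    induction n with
    | zero => simp
    | succ n ih =>
      rw [Finset.sum_range_succ]
      have hx : 1 ≤ a + n := by linarith [Nat.cast_nonneg (α := ℝ) n]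
      have h1 : 1 / (a + n) ^ 2 ≤ 2 / (a + n) - 2 / (a + (n + 1 : ℕ)) := by
        push_cast
        rw [← add_assoc]
        set x := a + (n : ℝ)
        have h2 : 2 / x - 2 / (x + 1) = 2 / (x * (x + 1)) := by
          field_simp; ring
        rw [h2, div_le_div_iff₀ (by positivity) (by positivity)]
        nlinarith
      linarith
  have : 0 ≤ 2 / (a + n) := by positivity
  linarith

lemma abs_sum_range_le {Ω : Type*} {X : ℕ → Ω → ℝ} {B : ℝ} (hB : ∀ i ω, |X i ω| ≤ B) (n : ℕ)
    (ω : Ω)  : |∑ i ∈ Finset.range n, X i ω| ≤ n * B := by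
  refine (Finset.abs_sum_le_sum_abs _ _).trans ((Finset.sum_le_card_nsmul _ _ B fun i _ =>
    hB i ω).trans ?_)
  simp

section WeakCorrelation

variable {Ω : Type*} [MeasurableSpace Ω] {μ : Measure Ω} [IsProbabilityMeasure μ]
  {X : ℕ → Ω → ℝ} {B D : ℝ}

lemma integrable_of_abs_le {Y : Ω → ℝ} (hY : AEStronglyMeasurable Y μ) {b : ℝ}
    (hb : ∀ ω, |Y ω| ≤ b) : Integrable Y μ :=
  Integrable.of_bound hY b (Eventually.of_forall hb)

/-- Second moment of the partial sums of a bounded sequence whose correlations, except between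
neighbours, are at most `D / (i + 1)`, where `i` is the smaller index. -/
lemma integral_sum_sq_le (hX : ∀ i, AEStronglyMeasurable (X i) μ) (hB : ∀ i ω, |X i ω| ≤ B)
    (hcorr : ∀ i j, i + 2 ≤ j → |∫ ω, X i ω * X j ω ∂μ| ≤ D / (i + 1)) (N : ℕ) :
    ∫ ω, (∑ i ∈ Finset.range N, X i ω) ^ 2 ∂μ ≤ (3 * B ^ 2 + 4 * D) * (N * Real.sqrt N) := by
  have hD : 0 ≤ D := by
    have := (abs_nonneg _).trans (hcorr 0 2 le_rfl)
    simpa using this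
  have hprod : ∀ i j, ∀ ω, |X i ω * X j ω| ≤ B ^ 2 := fun i j ω => by
    rw [abs_mul, sq]
    exact mul_le_mul (hB i ω) (hB j ω) (abs_nonneg _) ((abs_nonneg _).trans (hB i ω))
  have hint : ∀ i j, Integrable (fun ω => X i ω * X j ω) μ := fun i j =>
    integrable_of_abs_le ((hX i).mul (hX j)) (hprod i j)
  have hint_le : ∀ i j, |∫ ω, X i ω * X j ω ∂μ| ≤ B ^ 2 := fun i j => by
    have := norm_integral_le_of_norm_le_const (μ := μ)
      (f := fun ω => X i ω * X j ω) (Eventually.of_forall (hprod i j))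
    simpa using this
  have hS : ∀ n, AEStronglyMeasurable (fun ω => ∑ i ∈ Finset.range n, X i ω) μ := fun n =>
    Finset.aestronglyMeasurable_fun_sum _ fun i _ => hX i
  induction N with
  | zero => simp
  | succ n ih =>
    have hcross : ∫ ω, (∑ i ∈ Finset.range n, X i ω) * X n ω ∂μ ≤ B ^ 2 + 2 * D * Real.sqrt n := by
      simp only [Finset.sum_mul]
      rw [integral_finsetSum _ fun i _ => hint i n]
      cases n with
      | zero => simp; positivity
      | succ m =>
        rw [Finset.sum_range_succ]
        have h1 : ∑ i ∈ Finset.range m, ∫ ω, X i ω * X (m + 1) ω ∂μ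
            ≤ ∑ i ∈ Finset.range m, D * (1 / ((i : ℝ) + 1)) := by
          refine Finset.sum_le_sum fun i hi => ?_
          rw [mul_one_div]
          have := Finset.mem_range.1 hi
          exact (le_abs_self _).trans (hcorr i (m + 1) (by omega))
        rw [← Finset.mul_sum] at h1
        have h2 := mul_le_mul_of_nonneg_left (sum_one_div_le_sqrt m) hD
        have h3 : Real.sqrt m ≤ Real.sqrt (m + 1 : ℕ) := Real.sqrt_le_sqrt (by push_cast; linarith)
        have h4 := (le_abs_self _).trans (hint_le m (m + 1))
        nlinarith
    have hexp : ∫ ω, (∑ i ∈ Finset.range (n + 1), X i ω) ^ 2 ∂μ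
        = ∫ ω, (∑ i ∈ Finset.range n, X i ω) ^ 2 ∂μ
          + 2 * ∫ ω, (∑ i ∈ Finset.range n, X i ω) * X n ω ∂μ + ∫ ω, X n ω * X n ω ∂μ := by
      have i1 : Integrable (fun ω => (∑ i ∈ Finset.range n, X i ω) ^ 2) μ :=
        integrable_of_abs_le ((hS n).pow 2) (b := (n * B) ^ 2) fun ω => by
          rw [abs_pow]; exact pow_le_pow_left₀ (abs_nonneg _) (abs_sum_range_le hB n ω) 2
      have i2 : Integrable (fun ω => (∑ i ∈ Finset.range n, X i ω) * X n ω) μ := by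
        simp only [Finset.sum_mul]
        exact integrable_finsetSum _ fun i _ => hint i n
      have i3 : Integrable (fun ω => 2 * ((∑ i ∈ Finset.range n, X i ω) * X n ω)) μ :=
        i2.const_mul 2
      rw [← integral_const_mul, ← integral_add i1 i3]
      have i4 : Integrable (fun ω => (∑ i ∈ Finset.range n, X i ω) ^ 2
          + 2 * ((∑ i ∈ Finset.range n, X i ω) * X n ω)) μ := i1.add i3
      rw [← integral_add i4 (hint n n)]
      congr 1; ext ω
      rw [Finset.sum_range_succ]; ring
    have hdiag := (le_abs_self _).trans (hint_le n n)
    rw [hexp]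
    push_cast
    set a := Real.sqrt n
    set b := Real.sqrt ((n : ℝ) + 1)
    have hab : a ≤ b := Real.sqrt_le_sqrt (by linarith)
    have hb : 1 ≤ b := Real.one_le_sqrt.2 (by linarith [Nat.cast_nonneg (α := ℝ) n])
    have hn : (0 : ℝ) ≤ n := Nat.cast_nonneg n
    have h5 : (3 * B ^ 2 + 4 * D) * (n * a) ≤ (3 * B ^ 2 + 4 * D) * (n * b) := by gcongr
    have h6 : D * a ≤ D * b := by gcongr
    have h7 : B ^ 2 * 1 ≤ B ^ 2 * b := by gcongr
    nlinarith

/-- Weak law: the averages converge to zero in `L²`. -/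
lemma tendsto_eLpNorm_average (hX : ∀ i, AEStronglyMeasurable (X i) μ)
    (hB : ∀ i ω, |X i ω| ≤ B)
    (hcorr : ∀ i j, i + 2 ≤ j → |∫ ω, X i ω * X j ω ∂μ| ≤ D / (i + 1)) :
    (∀ N : ℕ, MemLp (fun ω => 1 / (N : ℝ) * ∑ i ∈ Finset.range (N + 1), X i ω) 2 μ) ∧
    Tendsto (fun N : ℕ =>
      eLpNorm (fun ω => 1 / (N : ℝ) * ∑ i ∈ Finset.range (N + 1), X i ω) 2 μ) atTop (𝓝 0) := by
  have hS : ∀ n, AEStronglyMeasurable (fun ω => ∑ i ∈ Finset.range n, X i ω) μ := fun n =>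
    Finset.aestronglyMeasurable_fun_sum _ fun i _ => hX i
  have hmem : ∀ N : ℕ, MemLp (fun ω => 1 / (N : ℝ) * ∑ i ∈ Finset.range (N + 1), X i ω) 2 μ :=
    fun N => (MemLp.of_bound (hS (N + 1)) _
      (Eventually.of_forall fun ω => abs_sum_range_le hB (N + 1) ω)).const_mul _
  refine ⟨hmem, ?_⟩
  set K := 3 * B ^ 2 + 4 * D with hK
  have hD : 0 ≤ D := by
    have := (abs_nonneg _).trans (hcorr 0 2 le_rfl)
    simpa using this
  have hK0 : 0 ≤ K := by positivity
  have hsq : Tendsto (fun N : ℕ =>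
      ∫ ω, (1 / (N : ℝ) * ∑ i ∈ Finset.range (N + 1), X i ω) ^ 2 ∂μ) atTop (𝓝 0) := by
    have hlim : Tendsto (fun N : ℕ => 4 * K * (Real.sqrt ((N : ℝ) + 1))⁻¹) atTop (𝓝 0) := by
      have h1 : Tendsto (fun N : ℕ => Real.sqrt ((N : ℝ) + 1)) atTop atTop :=
        Real.tendsto_sqrt_atTop.comp
          (tendsto_atTop_add_const_right _ 1 tendsto_natCast_atTop_atTop)
      simpa using h1.inv_tendsto_atTop.const_mul (4 * K)
    refine squeeze_zero' (Eventually.of_forall fun N => integral_nonneg fun ω => sq_nonneg _)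
      ?_ hlim
    filter_upwards [eventually_ge_atTop 1] with N hN
    have hN1 : (1 : ℝ) ≤ N := by exact_mod_cast hN
    have h2 := integral_sum_sq_le hX hB hcorr (N + 1)
    simp only [mul_pow]
    rw [integral_const_mul]
    push_cast at h2
    set b := Real.sqrt ((N : ℝ) + 1)
    have hb2 : b ^ 2 = N + 1 := Real.sq_sqrt (by positivity)
    have hb : 0 < b := Real.sqrt_pos.2 (by positivity)
    calc (1 / (N : ℝ)) ^ 2 * ∫ ω, (∑ i ∈ Finset.range (N + 1), X i ω) ^ 2 ∂μ
        ≤ (1 / (N : ℝ)) ^ 2 * (K * ((N + 1) * b)) := by gcongr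
      _ ≤ (2 / ((N : ℝ) + 1)) ^ 2 * (K * ((N + 1) * b)) := by
          have : 1 / (N : ℝ) ≤ 2 / (N + 1) := by
            rw [div_le_div_iff₀ (by positivity) (by positivity)]; linarith
          gcongr
      _ = 4 * K * b⁻¹ := by rw [← hb2]; field_simp; ring
  have heq : ∀ N : ℕ, eLpNorm (fun ω => 1 / (N : ℝ) * ∑ i ∈ Finset.range (N + 1), X i ω) 2 μ
      = ENNReal.ofReal
        (Real.sqrt (∫ ω, (1 / (N : ℝ) * ∑ i ∈ Finset.range (N + 1), X i ω) ^ 2 ∂μ)) := fun N => by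
    rw [(hmem N).eLpNorm_eq_integral_rpow_norm two_ne_zero ENNReal.ofNat_ne_top,
      Real.sqrt_eq_rpow]
    simp [mul_pow]
  simp only [heq]
  have h3 := (ENNReal.continuous_ofReal.comp Real.continuous_sqrt).tendsto 0
  simp only [Function.comp_def, Real.sqrt_zero, ENNReal.ofReal_zero] at h3
  exact h3.comp hsq

/-- Strong law: the second moments are summable along fourth powers, and between consecutive fourth
powers the partial sums of the nonnegative sequence `X + B` are monotone. -/
lemma ae_tendsto_average (hX : ∀ i, AEStronglyMeasurable (X i) μ)
    (hB : ∀ i ω, |X i ω| ≤ B)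
    (hcorr : ∀ i j, i + 2 ≤ j → |∫ ω, X i ω * X j ω ∂μ| ≤ D / (i + 1)) :
    ∀ᵐ ω ∂μ, Tendsto (fun N : ℕ => 1 / (N : ℝ) * ∑ i ∈ Finset.range (N + 1), X i ω)
      atTop (𝓝 0) := by
  have hS : ∀ n, AEStronglyMeasurable (fun ω => ∑ i ∈ Finset.range n, X i ω) μ := fun n =>
    Finset.aestronglyMeasurable_fun_sum _ fun i _ => hX i
  set K := 3 * B ^ 2 + 4 * D with hK
  set Y : ℕ → Ω → ℝ := fun k ω =>
    ((∑ i ∈ Finset.range (k ^ 4), X i ω) / ((k ^ 4 : ℕ) : ℝ)) ^ 2 with hY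
  have hYm : ∀ k, AEStronglyMeasurable (Y k) μ := fun k => by
    simp only [hY, div_eq_mul_inv]
    exact ((hS (k ^ 4)).mul_const _).pow 2
  have hYint : ∀ k, Integrable (Y k) μ := fun k =>
    integrable_of_abs_le (hYm k) (b := ((k ^ 4 : ℕ) * B / ((k ^ 4 : ℕ) : ℝ)) ^ 2) fun ω => by
      simp only [hY]
      rw [abs_pow, abs_div, Nat.abs_cast]
      have := abs_sum_range_le hB (k ^ 4) ω
      gcongr
  have hYle : ∀ k : ℕ, ∫ ω, Y k ω ∂μ ≤ K * (1 / (k : ℝ) ^ 2) := fun k => by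
    rcases Nat.eq_zero_or_pos k with rfl | hk
    · simp [hY]
    · have hk' : (0 : ℝ) < k := by exact_mod_cast hk
      have h1 := integral_sum_sq_le hX hB hcorr (k ^ 4)
      simp only [hY, div_pow]
      rw [integral_div, div_le_iff₀ (by positivity)]
      refine h1.trans (le_of_eq ?_)
      have h2 : Real.sqrt ((k ^ 4 : ℕ) : ℝ) = (k : ℝ) ^ 2 := by
        rw [show ((k ^ 4 : ℕ) : ℝ) = ((k : ℝ) ^ 2) ^ 2 by push_cast; ring,
          Real.sqrt_sq (by positivity)]
      rw [h2]; push_cast; field_simp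
      ring
  have hsum : ∑' k, ∫⁻ ω, ENNReal.ofReal (Y k ω) ∂μ ≠ ⊤ := by
    have h1 : Summable fun k : ℕ => K * (1 / (k : ℝ) ^ 2) :=
      (Real.summable_one_div_nat_pow.2 (by norm_num)).mul_left K
    refine ne_top_of_le_ne_top h1.tsum_ofReal_ne_top (ENNReal.tsum_le_tsum fun k => ?_)
    rw [← ofReal_integral_eq_lintegral_ofReal (hYint k)
      (Eventually.of_forall fun ω => sq_nonneg _)]
    exact ENNReal.ofReal_le_ofReal (hYle k)
  have hae : ∀ᵐ ω ∂μ, ∑' k, ENNReal.ofReal (Y k ω) < ⊤ := by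
    refine ae_lt_top' (AEMeasurable.tsum fun k =>
      (hYm k).aemeasurable.ennreal_ofReal) ?_
    rwa [lintegral_tsum fun k => (hYm k).aemeasurable.ennreal_ofReal]
  filter_upwards [hae] with ω hω
  have hY0 : Tendsto (fun k => Y k ω) atTop (𝓝 0) := by
    have h1 := (ENNReal.tendsto_toReal ENNReal.zero_ne_top).comp
      (ENNReal.tendsto_atTop_zero_of_tsum_ne_top hω.ne)
    simpa [Function.comp_def, hY, ENNReal.toReal_ofReal, sq_nonneg] using h1
  have hsub : Tendsto (fun k : ℕ => (∑ i ∈ Finset.range (k ^ 4), X i ω) / ((k ^ 4 : ℕ) : ℝ))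
      atTop (𝓝 0) := by
    rw [tendsto_zero_iff_abs_tendsto_zero]
    have h1 := (Real.continuous_sqrt.tendsto 0).comp hY0
    simpa [hY, Function.comp_def, Real.sqrt_sq_eq_abs] using h1
  have hfull : Tendsto (fun n : ℕ => (∑ i ∈ Finset.range n, (X i ω + B)) / n) atTop (𝓝 B) := by
    refine tendsto_div_of_monotone_of_exists_subseq_tendsto_div _ B ?_ fun a ha =>
      ⟨fun k => k ^ 4, ?_, tendsto_pow_atTop (by norm_num), ?_⟩
    · refine monotone_nat_of_le_succ fun n => ?_
      rw [Finset.sum_range_succ]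
      linarith [(abs_le.1 (hB n ω)).1]
    · have h1 : Tendsto (fun k : ℕ => (1 + 1 / (k : ℝ)) ^ 4) atTop (𝓝 1) := by
        simpa using (tendsto_one_div_atTop_nhds_zero_nat (𝕜 := ℝ)).const_add 1 |>.pow 4
      filter_upwards [h1.eventually (gt_mem_nhds ha), eventually_ge_atTop 1] with k hk hk1
      have hk' : (0 : ℝ) < k := by exact_mod_cast hk1
      have h2 : (1 + 1 / (k : ℝ)) ^ 4 * (k : ℝ) ^ 4 = ((k : ℝ) + 1) ^ 4 := by
        rw [← mul_pow]; congr 1; field_simp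
      push_cast
      rw [← h2]
      gcongr
    · have h1 : Tendsto (fun k : ℕ => (∑ i ∈ Finset.range (k ^ 4), X i ω) / ((k ^ 4 : ℕ) : ℝ) + B)
          atTop (𝓝 B) := by simpa using hsub.add_const B
      refine h1.congr' ?_
      filter_upwards [eventually_ge_atTop 1] with k hk
      have hk' : ((k ^ 4 : ℕ) : ℝ) ≠ 0 := by positivity
      rw [Finset.sum_add_distrib, Finset.sum_const, Finset.card_range, nsmul_eq_mul]
      field_simp
  have hlast : Tendsto (fun N : ℕ => 1 / (N : ℝ) * X N ω) atTop (𝓝 0) :=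
    (tendsto_one_div_atTop_nhds_zero_nat (𝕜 := ℝ)).zero_mul_isBoundedUnder_le
      ⟨B, eventually_map.2 (Eventually.of_forall fun i => hB i ω)⟩
  have htot := (hfull.sub_const B).add hlast
  simp only [sub_self, add_zero] at htot
  refine htot.congr' ?_
  filter_upwards [eventually_ge_atTop 1] with N hN
  have hN' : (N : ℝ) ≠ 0 := by positivity
  rw [Finset.sum_range_succ, Finset.sum_add_distrib, Finset.sum_const, Finset.card_range,
    nsmul_eq_mul]
  field_simp
  ring

end WeakCorrelation

/-! ### Correlations along the composition -/

lemma integral_comp_of_continuous {T : T2 → T2} (hT : MeasurePreserving T volume volume)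
    {h : T2 → ℝ} (hh : Continuous h) : ∫ p, h (T p) = ∫ p, h p := by
  have := integral_map (μ := (volume : Measure T2)) hT.measurable.aemeasurable (f := h)
    hh.aestronglyMeasurable
  rw [hT.map_eq] at this
  exact this.symm

/-- If `r k ^ (-α) ≤ T / k ^ 2`, then the correlation of `φ ∘ Fⁱ` with `φ ∘ Fʲ` is `O(1 / i)` for
`j ≥ i + 2`, by invariance of the measure and decay of correlations from time `i` on. -/
lemma abs_correlation_orbit_le {K₀ K₁ α C B T : ℝ} {M₀ : ℕ} (hK₀ : 0 < K₀) (hK₁ : 0 < K₁)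
    (hα0 : 0 < α) (hα1 : α ≤ 1) {φ : T2 → ℝ} (hφ : HolderBound C α φ) (hB : ∀ p, |φ p| ≤ B)
    (h0 : ∫ p, φ p = 0) {r : ℕ → ℝ} {f : ℕ → ℝ → ℝ} (hf : AdmissibleSeq K₀ K₁ M₀ r f)
    (hT : ∀ k : ℕ, 1 ≤ k → r k ^ (-α) ≤ T / (k : ℝ) ^ 2) {i j : ℕ} (hij : i + 2 ≤ j) :
    |∫ p, φ (compMap f i p) * φ (compMap f j p)|
      ≤ B * (curveConst K₀ K₁ M₀ α C B + C) * (2 * T) / (i + 1) := by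
  obtain ⟨n, rfl⟩ := Nat.exists_eq_add_of_le hij
  have hφc := hφ.continuous hα0
  have hB0 : 0 ≤ B := (abs_nonneg _).trans (hB 0)
  have hC := hφ.nonneg
  have hA0 : 0 ≤ B * (curveConst K₀ K₁ M₀ α C B + C) := by
    have := lossConst_nonneg hK₀ hK₁ M₀
    unfold curveConst; positivity
  have hT0 : 0 ≤ T := by
    have h1 : 0 ≤ r 1 ^ (-α) := Real.rpow_nonneg
      (by linarith [(hf 1 le_rfl).1, one_le_rootThreshold hK₀ hK₁]) _
    have := h1.trans (hT 1 le_rfl)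
    simpa using this
  have hfi := hf.shift i
  rw [add_assoc, add_comm 2 n, compMap_add]
  have hinv := integral_comp_of_continuous (hf.measurePreserving_compMap i)
    (h := fun p => φ p * φ (compMap (fun k => f (k + i)) (n + 2) p))
    (hφc.mul (hφc.comp (hfi.continuous_compMap _)))
  simp only [Function.comp]
  rw [hinv]
  refine (abs_correlation_le hK₀ hK₁ hα0 hα1 hφ hB h0 n hfi).trans ?_
  rw [mul_div_assoc]
  refine mul_le_mul_of_nonneg_left ?_ hA0
  have h1 : ∀ k ∈ Finset.range (n + 2), r (k + 1 + i) ^ (-α)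
      ≤ T * (1 / (((i : ℝ) + 1) + k) ^ 2) := fun k _ => by
    refine (hT (k + 1 + i) (by omega)).trans (le_of_eq ?_)
    push_cast
    rw [mul_one_div]; congr 2; ring
  refine (Finset.sum_le_sum h1).trans ?_
  rw [← Finset.mul_sum]
  have h2 := sum_one_div_sq_le ((i : ℝ) + 1) (by linarith [Nat.cast_nonneg (α := ℝ) i]) (n + 2)
  calc T * ∑ k ∈ Finset.range (n + 2), 1 / (((i : ℝ) + 1) + k) ^ 2 ≤ T * (2 / (i + 1)) := by gcongr
    _ = 2 * T / (i + 1) := by ring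

lemma exists_le_div_sq_of_tendsto {a : ℕ → ℝ}
    (h : Tendsto (fun N : ℕ => (N : ℝ) ^ 2 * a N) atTop (𝓝 0)) :
    ∃ T : ℝ, ∀ k : ℕ, 1 ≤ k → a k ≤ T / (k : ℝ) ^ 2 := by
  obtain ⟨T, hT⟩ := h.bddAbove_range
  refine ⟨T, fun k hk => ?_⟩
  have hk' : (0 : ℝ) < k := by exact_mod_cast hk
  rw [le_div_iff₀ (by positivity), mul_comm]
  exact hT ⟨k, rfl⟩

lemma tendsto_sq_of_tendsto_rpow {a : ℕ → ℝ} (ha : ∀ k, 1 ≤ k → 0 ≤ a k) {ε : ℝ} (hε : 0 < ε)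
    (h : Tendsto (fun N : ℕ => (N : ℝ) ^ (4 + ε) * a N) atTop (𝓝 0)) :
    Tendsto (fun N : ℕ => (N : ℝ) ^ 2 * a N) atTop (𝓝 0) := by
  refine squeeze_zero' ?_ ?_ h
  · filter_upwards [eventually_ge_atTop 1] with N hN
    exact mul_nonneg (by positivity) (ha N hN)
  · filter_upwards [eventually_ge_atTop 1] with N hN
    have hN' : (1 : ℝ) ≤ N := by exact_mod_cast hN
    refine mul_le_mul_of_nonneg_right ?_ (ha N hN)
    rw [← Real.rpow_natCast]
    exact Real.rpow_le_rpow_of_exponent_le hN' (by push_cast; linarith)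

end NonautStdMap

open NonautStdMap

theorem theoremA (K₀ K₁ : ℝ) (hK₀ : 0 < K₀) (hK₁ : 0 < K₁) (M₀ : ℕ)
    (α : ℝ) (hα0 : 0 < α) (hα1 : α ≤ 1) :
    ∃ L₀ : ℝ, 0 < L₀ ∧
      ∀ (L : ℕ → ℝ) (f : ℕ → ℝ → ℝ),
        MonotoneOn L (Set.Ici 1) → L₀ ≤ L 1 →
        (∀ n : ℕ, 1 ≤ n → NonautStdMap.Admissible K₀ K₁ M₀ (L n) (f n)) →
        ∀ φ : NonautStdMap.T2 → ℝ,
          NonautStdMap.IsHolder α φ → (∫ p, φ p ∂volume) = 0 →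
          (Tendsto (fun N : ℕ => (N : ℝ) ^ 2 * L N ^ (-(α / (3 * α + 4)))) atTop (𝓝 0) →
            (∀ N : ℕ, MemLp (NonautStdMap.timeAverage f φ N) 2 volume) ∧
            Tendsto (fun N : ℕ => eLpNorm (NonautStdMap.timeAverage f φ N) 2 volume)
              atTop (𝓝 0)) ∧
          (∀ ε : ℝ, 0 < ε →
            Tendsto (fun N : ℕ => (N : ℝ) ^ (4 + ε) * L N ^ (-(α / (3 * α + 4))))
              atTop (𝓝 0) →
            ∀ᵐ p ∂(volume : Measure NonautStdMap.T2),
              Tendsto (fun N : ℕ => NonautStdMap.timeAverage f φ N p) atTop (𝓝 0)) := by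
  have hR := one_le_rootThreshold hK₀ hK₁
  refine ⟨rootThreshold K₀ K₁ ^ 4, by positivity, fun L f hmono hL hadm φ hφ h0 => ?_⟩
  obtain ⟨C, hφ⟩ := hφ.exists_holderBound
  have hφc := hφ.continuous hα0
  obtain ⟨B, hB⟩ : ∃ B, ∀ p, |φ p| ≤ B := by
    obtain ⟨B, hB⟩ := isCompact_univ.exists_bound_of_continuousOn hφc.continuousOn
    exact ⟨B, fun p => hB p (Set.mem_univ p)⟩
  have hLn : ∀ n, 1 ≤ n → rootThreshold K₀ K₁ ^ 4 ≤ L n := fun n hn =>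
    hL.trans (hmono (Set.mem_Ici.2 le_rfl) (Set.mem_Ici.2 hn) hn)
  have hL1 : ∀ n, 1 ≤ n → 1 ≤ L n := fun n hn => (one_le_pow₀ hR).trans (hLn n hn)
  set r : ℕ → ℝ := fun n => L n ^ (1 / 4 : ℝ) with hr
  have hf : AdmissibleSeq K₀ K₁ M₀ r f := fun n hn => by
    have h1 : r n ^ 4 = L n := by
      simp only [hr]
      rw [← Real.rpow_natCast, ← Real.rpow_mul (by linarith [hL1 n hn])]
      norm_num
    have h2 : 0 ≤ r n := Real.rpow_nonneg (by linarith [hL1 n hn]) _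
    refine ⟨le_of_pow_le_pow_left₀ (n := 4) (by norm_num) h2 (by rw [h1]; exact hLn n hn), ?_⟩
    rw [h1]; exact hadm n hn
  -- The exponent `α / 4` of the losses is better than the one in the hypothesis.
  have hrate : ∀ n, 1 ≤ n → r n ^ (-α) ≤ L n ^ (-(α / (3 * α + 4))) := fun n hn => by
    simp only [hr]
    rw [← Real.rpow_mul (by linarith [hL1 n hn])]
    refine Real.rpow_le_rpow_of_exponent_le (hL1 n hn) ?_
    have : α / (3 * α + 4) ≤ α / 4 := div_le_div_of_nonneg_left hα0.le (by norm_num) (by linarith)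
    linarith
  have hXm : ∀ i, AEStronglyMeasurable (fun p => φ (compMap f i p)) (volume : Measure T2) :=
    fun i => (hφc.comp (hf.continuous_compMap i)).aestronglyMeasurable
  have hcorr : Tendsto (fun N : ℕ => (N : ℝ) ^ 2 * L N ^ (-(α / (3 * α + 4)))) atTop (𝓝 0) →
      ∃ D : ℝ, ∀ i j, i + 2 ≤ j →
        |∫ p : T2, φ (compMap f i p) * φ (compMap f j p)| ≤ D / (i + 1) := fun h => by
    obtain ⟨T, hT⟩ := exists_le_div_sq_of_tendsto h
    exact ⟨_, fun i j hij => abs_correlation_orbit_le hK₀ hK₁ hα0 hα1 hφ hB h0 hf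
      (fun k hk => (hrate k hk).trans (hT k hk)) hij⟩
  refine ⟨fun h => ?_, fun ε hε h => ?_⟩
  · obtain ⟨D, hD⟩ := hcorr h
    exact tendsto_eLpNorm_average hXm (fun i p => hB _) hD
  · obtain ⟨D, hD⟩ := hcorr (tendsto_sq_of_tendsto_rpow
      (fun k hk => Real.rpow_nonneg (by linarith [hL1 k hk]) _) hε h)
    exact ae_tendsto_average hXm (fun i p => hB _) hD
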